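/- **Setting.** Let $n\ge 2$, $T\ge 1$. Let $\mathcal G_0$ be a connected simple graph on the nodes $[n]=\{1,\dots,n\}$ and let $\mathcal G_1,\mathcal G_2,\dots,\mathcal G_T$ be obtained by adding at most one edge per step: the Laplacians satisfy $L_t=L_{t-1}+u_t\,a_{l_t}a_{l_t}^T$ with $u_t\in\{0,1\}$, where, if $u_t=1$, $l_t$ is an edge not in $\mathcal G_{t-1}$; $a_l=e_i-e_j$ is the edge vector of $l\sim(i,j)$, and $u_t=0$ for $t>T$. Let $\delta_{\max}$ be the maximum degree of $\mathcal G_0,\dots,\mathcal G_T$ and $P_t=I-\frac{1}{2(1+\delta_{\max})}L_t$. Write $\lambda_1\ge\dots\ge\lambda_n$ for eigenvalues, $\sigma_2$ for the second largest singular value, $\sigma=\sigma_2(P_0)$, and let $v_t$ be a unit eigenvector of $L_t$ for $\lambda_{n-1}(L_t)$. Put $b_t^{-1}=2(1+\delta_{\max})+\frac{12(1+\delta_{\max})}{\lambda_{n-2}(L_t)-\lambda_{n-1}(L_t)}$, with $b_t=0$ if $\lambda_{n-2}(L_t)=\lambda_{n-1}(L_t)$. Let $\delta^*$ be the optimal value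 of the problem: minimize $\delta$ over $\beta>0$ and integers $\delta\ge1$ subject to $$\log\beta=\sum_{k=1}^{\delta-1}\log\Bigl(1-\frac{\sum_{i=1}^k u_i b_{i-1}(a_{l_i}^Tv_{i-1})^2}{\sigma}\Bigr),\qquad \delta\ \ge\ \frac{\log (T\sqrt n)}{\log\sigma^{-1}}-\frac{\log\beta^{-1}}{\log\sigma^{-1}} .$$ Let $\|\cdot\|$ be a norm on $\mathbb R^p$ with dual norm $\|\cdot\|_*$, $\mathcal X\subseteq\mathbb R^p$ a closed convex set containing $0$, and $f_1,\dots,f_n$ functions that are convex and $L$-Lipschitz on $\mathcal X$ with respect to $\|\cdot\|$ ($L>0$). Let $f=\frac1n\sum_i f_i$, let $x^*$ minimize $f$ over $\mathcal X$, and let $\psi\ge0$ with $\psi(0)=0$ be $1$-strongly convex on $\mathcal X$ with respect to $\|\cdot\|$, with $\psi(x^*)\le R^2$, $R>0$. Distributed dual averaging (DDA) starts from $z_i(0)=0$ and any $x_i(0)\in\mathcal X$ and iterates $$z_i(t+1)=\sum_{j}[P_t]_{ji}z_j(t)+g_i(t),\qquad x_i(t+1)\in\operatorname*{arg\,min}_{x\in\mathcal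 X}\Bigl\{z_i(t+1)^Tx+\tfrac1{\alpha_t}\psi(x)\Bigr\},$$ where $g_i(t)$ is a subgradient of $f_i$ on $\mathcal X$ at $x_i(t)$ with $\|g_i(t)\|_*\le L$. The step sizes are $\alpha_t=c\,R\sqrt{1-\sigma}/(L\sqrt t)$ for $t\ge1$, and $\alpha_0=\alpha_1$, where $c>0$ is a fixed constant. Let $\hat x_i(T)=\frac1T\sum_{t=1}^Tx_i(t)$. **Theorem 2.** The optimal value $\delta^*$ is attained, $1\le\delta^*\le\bigl\lceil \log(T\sqrt n)/\log\sigma^{-1}\bigr\rceil$, and for every agent $i\in[n]$ $$f(\hat x_i(T))-f(x^*)=\mathcal O\Bigl(\frac{RL\sqrt{1-\sigma_2(P_0)}\;\delta^*}{\sqrt T}\Bigr)$$ in the following sense. There are a number $C$ that depends only on $c$, and numbers $T_0(\sigma)$, $K(\sigma)$ that depend only on $c$ and $\sigma=\sigma_2(P_0)$, such that the left side is at most $C\,RL\sqrt{1-\sigma}\,\delta^*/\sqrt T$ whenever $T\ge T_0(\sigma)$, and at most $K(\sigma)\,RL\sqrt{1-\sigma}\,\delta^*/\sqrt T$ for every $T\ge1$.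 -/

import Mathlib

open scoped Classical in
/-- The Laplacian matrix `D - A` of a graph on `n` nodes, over `ℝ`. -/
noncomputable def lap {n : ℕ} (G : SimpleGraph (Fin n)) : Matrix (Fin n) (Fin n) ℝ :=
  G.lapMatrix ℝ

theorem lap_isHermitian {n : ℕ} (G : SimpleGraph (Fin n)) : (lap G).IsHermitian := by
  classical
  unfold lap
  exact SimpleGraph.isHermitian_lapMatrix ℝ G

/-- `lamLap G k` is `λ_k`, the `k`-th largest eigenvalue (`1 ≤ k ≤ n`, with multiplicity) of the
Laplacian of `G`; thus `lamLap G (n - 1)` is the algebraic connectivity. -/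
noncomputable def lamLap {n : ℕ} (G : SimpleGraph (Fin n)) (k : ℕ) : ℝ :=
  if h : 1 ≤ k ∧ k ≤ n then
    (lap_isHermitian G).eigenvalues₀ ⟨k - 1, by rw [Fintype.card_fin]; omega⟩
  else 0

/-- The second largest singular value of a square matrix (Mathlib counts from `0`). -/
noncomputable def sigma2 {n : ℕ} (P : Matrix (Fin n) (Fin n) ℝ) : ℝ :=
  (Matrix.toEuclideanLin P).singularValues 1

/-- The edge vector `e_i - e_j` of an edge with end nodes `i` and `j`. -/
def edgeVec {n : ℕ} (e : Fin n × Fin n) : Fin n → ℝ :=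
  Pi.single e.1 1 - Pi.single e.2 1

/-- A network on `n` nodes over the time horizon `T`, which starts from a connected graph `G 0` and
grows by at most one edge per time step: `L_t = L_{t-1} + u_t a_{l_t} a_{l_t}ᵀ`, where `u_t = 1` if
an edge is added at time `t` and `u_t = 0` otherwise, and an added edge `l_t` is not in `G (t - 1)`.
No edge is added after time `T`. -/
structure EvolvingNetwork (n T : ℕ) where
  /-- the graph at time `t` -/
  G : ℕ → SimpleGraph (Fin n)
  /-- the edge schedule -/
  u : ℕ → ℝ
  /-- the edge added at time `t` if `u t = 1` (irrelevant otherwise) -/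
  l : ℕ → Fin n × Fin n
  connected : (G 0).Connected
  u_binary : ∀ t, u t = 0 ∨ u t = 1
  l_new : ∀ t, 1 ≤ t → u t = 1 → (l t).1 ≠ (l t).2 ∧ ¬ (G (t - 1)).Adj (l t).1 (l t).2
  step : ∀ t, 1 ≤ t →
    lap (G t) = lap (G (t - 1)) + u t • Matrix.vecMulVec (edgeVec (l t)) (edgeVec (l t))
  u_after : ∀ t, T < t → u t = 0

namespace EvolvingNetwork

variable {n T : ℕ}

open scoped Classical in
/-- The maximum degree of the graphs `G 0, …, G T`. -/
noncomputable def degMax (N : EvolvingNetwork n T) : ℕ :=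
  (Finset.range (T + 1)).sup fun t => (N.G t).maxDegree

/-- The weight matrix `P_t = I - L_t / (2 (1 + δ_max))`. -/
noncomputable def P (N : EvolvingNetwork n T) (t : ℕ) : Matrix (Fin n) (Fin n) ℝ :=
  1 - (1 / (2 * (1 + (N.degMax : ℝ)))) • lap (N.G t)

/-- `v` is a choice, at each time, of a unit eigenvector of `L_t` for the eigenvalue
`λ_{n-1}(L_t)`. -/
def IsConnectivityEigenvector (N : EvolvingNetwork n T) (v : ℕ → Fin n → ℝ) : Prop :=
  ∀ t ≤ T, v t ⬝ᵥ v t = 1 ∧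
    Matrix.mulVec (lap (N.G t)) (v t) = lamLap (N.G t) (n - 1) • v t

/-- The spectral gap `λ_{n-2}(L_t) - λ_{n-1}(L_t)`. -/
noncomputable def gap (N : EvolvingNetwork n T) (t : ℕ) : ℝ :=
  lamLap (N.G t) (n - 2) - lamLap (N.G t) (n - 1)

/-- The coefficient `b_t`, with
`b_t⁻¹ = 2 (1 + δ_max) + 12 (1 + δ_max) / (λ_{n-2}(L_t) - λ_{n-1}(L_t))`;
if the gap vanishes, then `b_t⁻¹ = ∞` and `b_t = 0`. -/
noncomputable def b (N : EvolvingNetwork n T) (t : ℕ) : ℝ :=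
  if N.gap t = 0 then 0
  else (2 * (1 + (N.degMax : ℝ)) + 12 * (1 + (N.degMax : ℝ)) / N.gap t)⁻¹

/-- The guaranteed decrease `∑_{i=1}^k u_i b_{i-1} (a_{l_i}ᵀ v_{i-1})²` of `σ₂` up to time `k`. -/
noncomputable def decrease (N : EvolvingNetwork n T) (v : ℕ → Fin n → ℝ) (k : ℕ) : ℝ :=
  ∑ i ∈ Finset.Icc 1 k, N.u i * N.b (i - 1) * (edgeVec (N.l i) ⬝ᵥ v (i - 1)) ^ 2

/-- The pairs `(β, δ)` that are feasible for the mixing time problem "minimize `δ`". -/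
def Feasible (N : EvolvingNetwork n T) (v : ℕ → Fin n → ℝ) (β : ℝ) (δ : ℕ) : Prop :=
  0 < β ∧ 1 ≤ δ ∧
  Real.log β = ∑ k ∈ Finset.Icc 1 (δ - 1), Real.log (1 - N.decrease v k / sigma2 (N.P 0)) ∧
  (δ : ℝ) ≥ Real.log (T * √n) / Real.log (sigma2 (N.P 0))⁻¹
    - Real.log β⁻¹ / Real.log (sigma2 (N.P 0))⁻¹

/-- `δ` is the optimal value of the mixing time problem. -/
def IsMixingTime (N : EvolvingNetwork n T) (v : ℕ → Fin n → ℝ) (δ : ℕ) : Prop :=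
  IsLeast {d : ℕ | ∃ β : ℝ, N.Feasible v β d} δ

end EvolvingNetwork

section DDA

variable {E : Type*} [NormedAddCommGroup E] [NormedSpace ℝ E] {n : ℕ}

/-- The network cost `(1/n) ∑ f_i`. -/
noncomputable def networkCost (f : Fin n → E → ℝ) (x : E) : ℝ :=
  (1 / (n : ℝ)) * ∑ i, f i x

/-- A distributed convex problem with its proximal function: a closed convex set `X` containing the
origin, local costs `f_i` that are convex and `L`-Lipschitz on `X`, and a function `ψ ≥ 0` with
`ψ 0 = 0` that is `1`-strongly convex on `X`, all with respect to the norm of `E`. -/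
structure IsDistributedProblem (X : Set E) (f : Fin n → E → ℝ) (L : ℝ) (ψ : E → ℝ) : Prop where
  isClosed : IsClosed X
  convex : Convex ℝ X
  zero_mem : (0 : E) ∈ X
  f_convex : ∀ i, ConvexOn ℝ X (f i)
  f_lipschitz : ∀ i, ∀ x ∈ X, ∀ y ∈ X, |f i x - f i y| ≤ L * ‖x - y‖
  ψ_strongConvex : StrongConvexOn X 1 ψ
  ψ_nonneg : ∀ x ∈ X, 0 ≤ ψ x
  ψ_zero : ψ 0 = 0

/-- `x_i(t)`, `z_i(t)`, `g_i(t)` are produced by distributed dual averaging with weight matrices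
`P_t` and step sizes `α_t` over the time horizon `T`, started from `z_i(0) = 0` and any
`x_i(0) ∈ X`. The dual variables and the subgradients live in the dual space, with the dual norm;
`g_i(t)` is a subgradient at `x_i(t)` of the `L`-Lipschitz function `f_i` on `X`, of dual norm at
most `L`, as are all subgradients of an `L`-Lipschitz function on the whole space. -/
structure IsDDARun (P : ℕ → Matrix (Fin n) (Fin n) ℝ) (X : Set E) (f : Fin n → E → ℝ) (L : ℝ)
    (ψ : E → ℝ) (α : ℕ → ℝ) (T : ℕ) (x : ℕ → Fin n → E) (z g : ℕ → Fin n → StrongDual ℝ E) :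
    Prop where
  z_zero : ∀ i, z 0 i = 0
  x_zero : ∀ i, x 0 i ∈ X
  subgradient : ∀ t ≤ T, ∀ i, ∀ y ∈ X, f i (x t i) + g t i (y - x t i) ≤ f i y
  subgradient_norm : ∀ t ≤ T, ∀ i, ‖g t i‖ ≤ L
  z_step : ∀ t < T, ∀ i, z (t + 1) i = (∑ j, P t j i • z t j) + g t i
  x_mem : ∀ t < T, ∀ i, x (t + 1) i ∈ X
  x_step : ∀ t < T, ∀ i, IsMinOn (fun y => z (t + 1) i y + 1 / α t * ψ y) X (x (t + 1) i)

/-- The running local average `(1/T) ∑_{t=1}^T x_i(t)`. -/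
noncomputable def runningAverage (x : ℕ → Fin n → E) (T : ℕ) (i : Fin n) : E :=
  (1 / (T : ℝ)) • ∑ t ∈ Finset.Icc 1 T, x t i

end DDA

/-! Each `N.P t` with `t ≤ T` is symmetric, doubly stochastic and positive semidefinite, so on the
complement of the constants it contracts by exactly `N.rate t = 1 - λ_{n-1}(L_t) / (2 (1 + δ_max))`,
and `N.rate 0` is `σ`. A variational estimate (`lamLap_add_le_of_edge`) shows that a new edge raises
`λ_{n-1}` by at least `(a ⬝ᵥ v)² g / (g + 6)`, where `g` is the spectral gap. Divided by `2 (1 +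
δ_max)` this is the summand of `decrease`, so `rate k ≤ σ - decrease k`.

Let `W m` be the product of `σ - decrease k` over `k < m` (`windowBound`). In logarithms,
feasibility of `δ` says exactly `T √n W δ ≤ 1` (`exists_feasible_iff`). Later windows contract at
least as well as the one at time `0`, so a column of a product of `m` weight matrices is within `min
(2, √n W m)` of uniform in `ℓ¹`. Windows shorter than `δ` cost at most `2` each and the others at
most `1 / T` each; hence every dual variable stays within `(2 δ + 1) L` of the running sum of
network averages (`sum_columnError_le`).

Centralized dual averaging driven by the averaged subgradients has a standard regret bound, and the
proximal map is Lipschitz, so the agents follow it up to `α_t (2 δ + 1) L`. With `q = √(1 - σ)` the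
error is at most `(R L / √T) (1 / (c q) + 2 + 29 c q δ)`. The terms without `δ` are absorbed once `1
/ q ≤ M q δ`. This holds with `M = 1 / (1 - σ)` because `δ ≥ 1`, and with `M = 1` for large `T`: all
factors of `W` are at least `1 / 2`, so `T ≤ 2 ^ δ` forces `δ ≥ 1 / (1 - σ)`. -/

/-! ### Courant–Fischer bounds for symmetric operators. -/

section MinMax

open Module

variable {E : Type*} [NormedAddCommGroup E] [InnerProductSpace ℝ E]

/-- There are fewer linear conditions than dimensions. Applied to the eigenvectors on one side of an
index, this yields both halves of the min-max principle. -/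
theorem exists_mem_ne_zero_forall_inner_eq_zero {ι : Type*} [Finite ι] (b : ι → E)
    (W : Submodule ℝ E) [FiniteDimensional ℝ W] (hW : Nat.card ι < finrank ℝ W) :
    ∃ w ∈ W, w ≠ 0 ∧ ∀ j, inner ℝ (b j) w = 0 := by
  have := Fintype.ofFinite ι
  let F : W →ₗ[ℝ] (ι → ℝ) := LinearMap.pi fun j => (innerₛₗ ℝ (b j)).comp W.subtype
  have hF : LinearMap.ker F ≠ ⊥ := by
    apply LinearMap.ker_ne_bot_of_finrank_lt
    simpa [Nat.card_eq_fintype_card] using hW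
  obtain ⟨w, hw, hw0⟩ := (Submodule.ne_bot_iff _).1 hF
  refine ⟨w, w.2, fun h => hw0 (Subtype.ext h), fun j => ?_⟩
  exact congrFun (LinearMap.mem_ker.1 hw) j

theorem OrthonormalBasis.sum_sq_inner {ι : Type*} [Fintype ι] (b : OrthonormalBasis ι ℝ E) (w : E) :
    ∑ j, inner ℝ (b j) w ^ 2 = ‖w‖ ^ 2 := by
  rw [← real_inner_self_eq_norm_sq, ← b.sum_inner_mul_inner]
  refine Finset.sum_congr rfl fun j _ => ?_
  rw [real_inner_comm, sq]

theorem norm_sq_sum_of_pairwise_orthogonal {ι : Type*} [Fintype ι] (e : ι → E)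
    (he : Pairwise fun j k => inner ℝ (e j) (e k) = 0) (a : ι → ℝ) :
    ‖∑ j, a j • e j‖ ^ 2 = ∑ j, a j ^ 2 * ‖e j‖ ^ 2 := by
  rw [← real_inner_self_eq_norm_sq, sum_inner]
  refine Finset.sum_congr rfl fun j _ => ?_
  rw [inner_sum, Finset.sum_eq_single j]
  · rw [inner_smul_left, inner_smul_right, real_inner_self_eq_norm_sq]
    simp; ring
  · intro k _ hk
    rw [inner_smul_left, inner_smul_right, he hk.symm]; simp
  · simp

theorem inner_apply_sum_of_pairwise_orthogonal {A : E →ₗ[ℝ] E} {ι : Type*} [Fintype ι] (e : ι → E)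
    (he : Pairwise fun j k => inner ℝ (A (e j)) (e k) = 0) (a : ι → ℝ) :
    inner ℝ (A (∑ j, a j • e j)) (∑ j, a j • e j) = ∑ j, a j ^ 2 * inner ℝ (A (e j)) (e j) := by
  rw [map_sum, sum_inner]
  refine Finset.sum_congr rfl fun j _ => ?_
  rw [inner_sum, Finset.sum_eq_single j]
  · rw [map_smul, inner_smul_left, inner_smul_right]
    simp; ring
  · intro k _ hk
    rw [map_smul, inner_smul_left, inner_smul_right, he hk.symm]; simp
  · simp

variable [FiniteDimensional ℝ E] {A : E →ₗ[ℝ] E} (hA : A.IsSymmetric) {n : ℕ} (hn : finrank ℝ E = n)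

theorem LinearMap.IsSymmetric.inner_apply_self_eq_sum (w : E) :
    inner ℝ (A w) w
      = ∑ j, hA.eigenvalues hn j * inner ℝ (hA.eigenvectorBasis hn j) w ^ 2 := by
  rw [← (hA.eigenvectorBasis hn).sum_inner_mul_inner]
  refine Finset.sum_congr rfl fun j _ => ?_
  rw [real_inner_comm, ← hA, hA.apply_eigenvectorBasis, inner_smul_left]
  simp; ring

/-- Upper bound in the min-max principle. -/
theorem LinearMap.IsSymmetric.eigenvalues_le_of_submodule (i : Fin n) {c : ℝ} (W : Submodule ℝ E)
    (hW : n ≤ i + finrank ℝ W) (h : ∀ w ∈ W, inner ℝ (A w) w ≤ c * ‖w‖ ^ 2) :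
    hA.eigenvalues hn i ≤ c := by
  obtain ⟨w, hw, hw0, hort⟩ := exists_mem_ne_zero_forall_inner_eq_zero
    (fun j : {j : Fin n // i < j} => hA.eigenvectorBasis hn j) W (by
      have : Fintype.card {j : Fin n // i < j} = n - 1 - i := by
        rw [Fintype.card_subtype, Finset.filter_lt_eq_Ioi, Fin.card_Ioi]
      rw [Nat.card_eq_fintype_card, this]
      omega)
  have h1 := h w hw
  have hpos : 0 < ‖w‖ ^ 2 := by positivity
  refine le_of_mul_le_mul_right (le_trans ?_ h1) hpos
  rw [hA.inner_apply_self_eq_sum hn, ← (hA.eigenvectorBasis hn).sum_sq_inner, Finset.mul_sum]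
  refine Finset.sum_le_sum fun j _ => ?_
  rcases lt_or_ge i j with hij | hij
  · simp [hort ⟨j, hij⟩]
  · gcongr
    exact hA.eigenvalues_antitone hn hij

/-- Lower bound in the min-max principle. -/
theorem LinearMap.IsSymmetric.le_eigenvalues_of_submodule (i : Fin n) {c : ℝ} (W : Submodule ℝ E)
    (hW : i < finrank ℝ W) (h : ∀ w ∈ W, c * ‖w‖ ^ 2 ≤ inner ℝ (A w) w) :
    c ≤ hA.eigenvalues hn i := by
  obtain ⟨w, hw, hw0, hort⟩ := exists_mem_ne_zero_forall_inner_eq_zero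
    (fun j : {j : Fin n // j < i} => hA.eigenvectorBasis hn j) W (by
      have : Fintype.card {j : Fin n // j < i} = i := by
        rw [Fintype.card_subtype, Finset.filter_gt_eq_Iio, Fin.card_Iio]
      rwa [Nat.card_eq_fintype_card, this])
  have h1 := h w hw
  have hpos : 0 < ‖w‖ ^ 2 := by positivity
  refine le_of_mul_le_mul_right (le_trans h1 ?_) hpos
  rw [hA.inner_apply_self_eq_sum hn, ← (hA.eigenvectorBasis hn).sum_sq_inner, Finset.mul_sum]
  refine Finset.sum_le_sum fun j _ => ?_
  rcases lt_or_ge j i with hij | hij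
  · simp [hort ⟨j, hij⟩]
  · gcongr
    exact hA.eigenvalues_antitone hn hij

/-- Upper bound in the min-max principle, from a family that is orthogonal for the inner product
and for the form of the operator. -/
theorem LinearMap.IsSymmetric.eigenvalues_le_of_family (i : Fin n) {c : ℝ} {m : ℕ} (e : Fin m → E)
    (he0 : ∀ j, e j ≠ 0) (he : Pairwise fun j k => inner ℝ (e j) (e k) = 0)
    (hAe : Pairwise fun j k => inner ℝ (A (e j)) (e k) = 0) (hm : n ≤ i + m)
    (h : ∀ j, inner ℝ (A (e j)) (e j) ≤ c * ‖e j‖ ^ 2) : hA.eigenvalues hn i ≤ c := by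
  refine hA.eigenvalues_le_of_submodule hn i (Submodule.span ℝ (Set.range e)) ?_ ?_
  · rw [finrank_span_eq_card (linearIndependent_of_ne_zero_of_inner_eq_zero he0 he)]
    simpa using hm
  · intro w hw
    obtain ⟨a, rfl⟩ := (Submodule.mem_span_range_iff_exists_fun ℝ).1 hw
    rw [norm_sq_sum_of_pairwise_orthogonal e he, inner_apply_sum_of_pairwise_orthogonal e hAe,
      Finset.mul_sum]
    refine Finset.sum_le_sum fun j _ => ?_
    nlinarith [mul_le_mul_of_nonneg_left (h j) (sq_nonneg (a j))]

/-- Lower bound in the min-max principle, from a family that is orthogonal for the inner product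
and for the form of the operator. -/
theorem LinearMap.IsSymmetric.le_eigenvalues_of_family (i : Fin n) {c : ℝ} {m : ℕ} (e : Fin m → E)
    (he0 : ∀ j, e j ≠ 0) (he : Pairwise fun j k => inner ℝ (e j) (e k) = 0)
    (hAe : Pairwise fun j k => inner ℝ (A (e j)) (e k) = 0) (hm : i < m)
    (h : ∀ j, c * ‖e j‖ ^ 2 ≤ inner ℝ (A (e j)) (e j)) : c ≤ hA.eigenvalues hn i := by
  refine hA.le_eigenvalues_of_submodule hn i (Submodule.span ℝ (Set.range e)) ?_ ?_
  · rw [finrank_span_eq_card (linearIndependent_of_ne_zero_of_inner_eq_zero he0 he)]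
    simpa using hm
  · intro w hw
    obtain ⟨a, rfl⟩ := (Submodule.mem_span_range_iff_exists_fun ℝ).1 hw
    rw [norm_sq_sum_of_pairwise_orthogonal e he, inner_apply_sum_of_pairwise_orthogonal e hAe,
      Finset.mul_sum]
    refine Finset.sum_le_sum fun j _ => ?_
    nlinarith [mul_le_mul_of_nonneg_left (h j) (sq_nonneg (a j))]

end MinMax

/-! ### Variational bounds for the Laplacian eigenvalues. -/

section Laplacian

open Matrix

theorem inner_toEuclideanLin_toLp {n : ℕ} (A : Matrix (Fin n) (Fin n) ℝ) (x y : Fin n → ℝ) :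
    inner ℝ (Matrix.toEuclideanLin A (WithLp.toLp 2 x)) (WithLp.toLp 2 y) = y ⬝ᵥ A *ᵥ x := by
  simp [EuclideanSpace.inner_toLp_toLp]

theorem inner_toLp_toLp_real {n : ℕ} (x y : Fin n → ℝ) :
    inner ℝ (WithLp.toLp 2 x) (WithLp.toLp 2 y) = x ⬝ᵥ y := by
  rw [EuclideanSpace.inner_toLp_toLp, star_trivial, dotProduct_comm]

theorem norm_sq_toLp {n : ℕ} (x : Fin n → ℝ) : ‖WithLp.toLp 2 x‖ ^ 2 = x ⬝ᵥ x := by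
  rw [← real_inner_self_eq_norm_sq, inner_toLp_toLp_real]

theorem dotProduct_self_pos {n : ℕ} {w : Fin n → ℝ} (hw : w ≠ 0) : 0 < w ⬝ᵥ w := by
  have h0 : 0 ≤ w ⬝ᵥ w := Finset.sum_nonneg fun i _ => mul_self_nonneg (w i)
  exact h0.lt_of_ne fun h => hw (dotProduct_self_eq_zero.1 h.symm)

theorem one_dotProduct_one_real (n : ℕ) : (1 : Fin n → ℝ) ⬝ᵥ 1 = n := by
  simp [dotProduct]

variable {n : ℕ} (G : SimpleGraph (Fin n))

open scoped Classical in
theorem dotProduct_lap_mulVec_self (w : Fin n → ℝ) :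
    w ⬝ᵥ lap G *ᵥ w = (∑ i, ∑ j, if G.Adj i j then (w i - w j) ^ 2 else 0) / 2 := by
  unfold lap
  rw [← Matrix.toLinearMap₂'_apply', SimpleGraph.lapMatrix_toLinearMap₂']

theorem lap_mulVec_one : lap G *ᵥ 1 = 0 := by
  classical
  unfold lap
  exact SimpleGraph.lapMatrix_mulVec_const_eq_zero G

theorem dotProduct_mulVec_comm {A : Matrix (Fin n) (Fin n) ℝ} (hA : A.IsHermitian)
    (x y : Fin n → ℝ) : x ⬝ᵥ A *ᵥ y = y ⬝ᵥ A *ᵥ x := by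
  have hA' : Aᵀ = A := by simpa [Matrix.IsHermitian] using hA
  rw [dotProduct_mulVec, ← mulVec_transpose, hA', dotProduct_comm]

theorem dotProduct_lap_mulVec_comm (x y : Fin n → ℝ) : x ⬝ᵥ lap G *ᵥ y = y ⬝ᵥ lap G *ᵥ x :=
  dotProduct_mulVec_comm (lap_isHermitian G) x y

theorem dotProduct_lap_mulVec_self_nonneg (w : Fin n → ℝ) : 0 ≤ w ⬝ᵥ lap G *ᵥ w := by
  classical
  rw [dotProduct_lap_mulVec_self]
  positivity

theorem one_dotProduct_lap_mulVec (w : Fin n → ℝ) : 1 ⬝ᵥ lap G *ᵥ w = 0 := by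
  rw [dotProduct_lap_mulVec_comm, lap_mulVec_one, dotProduct_zero]

variable {G}

theorem lamLap_le_of_family {k m : ℕ} (hk : 1 ≤ k) (hkn : k ≤ n) {c : ℝ} (e : Fin m → Fin n → ℝ)
    (he0 : ∀ j, e j ≠ 0) (he : ∀ j l, j < l → e j ⬝ᵥ e l = 0)
    (hAe : ∀ j l, j < l → e j ⬝ᵥ lap G *ᵥ e l = 0) (hm : n + 1 ≤ k + m)
    (h : ∀ j, e j ⬝ᵥ lap G *ᵥ e j ≤ c * (e j ⬝ᵥ e j)) : lamLap G k ≤ c := by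
  rw [lamLap, dif_pos ⟨hk, hkn⟩]
  refine LinearMap.IsSymmetric.eigenvalues_le_of_family _ _ _ (fun j => WithLp.toLp 2 (e j))
    ?_ ?_ ?_ (m := m) ?_ ?_
  · intro j hj
    exact he0 j (by simpa using hj)
  · intro j l hjl
    simp only [inner_toLp_toLp_real]
    rcases lt_or_gt_of_ne hjl with h1 | h1
    · exact he _ _ h1
    · rw [dotProduct_comm]; exact he _ _ h1
  · intro j l hjl
    simp only [inner_toEuclideanLin_toLp]
    rcases lt_or_gt_of_ne hjl with h1 | h1
    · rw [dotProduct_lap_mulVec_comm]; exact hAe _ _ h1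
    · exact hAe _ _ h1
  · simp; omega
  · intro j
    rw [inner_toEuclideanLin_toLp, norm_sq_toLp]
    exact h j

theorem one_ne_zero_of_two_le (hn : 2 ≤ n) : (1 : Fin n → ℝ) ≠ 0 := fun h => by
  simpa using congrFun h ⟨0, by omega⟩

/-- The algebraic connectivity bounds the Rayleigh quotient on the complement of the constants. -/
theorem lamLap_mul_le_of_orthogonal_one (hn : 2 ≤ n) {w : Fin n → ℝ} (hw : 1 ⬝ᵥ w = 0) :
    lamLap G (n - 1) * (w ⬝ᵥ w) ≤ w ⬝ᵥ lap G *ᵥ w := by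
  by_cases hw0 : w = 0
  · simp [hw0]
  have hpos := dotProduct_self_pos hw0
  rw [← le_div_iff₀ hpos]
  -- The constant `c` is the Rayleigh quotient of `w`. It dominates the form on the plane spanned by
  -- `1` and `w`, since the form vanishes on constants.
  refine lamLap_le_of_family (by omega) (by omega) ![1, w] ?_ ?_ ?_ (by omega) ?_
  · intro j; fin_cases j
    · exact one_ne_zero_of_two_le hn
    · exact hw0
  · intro j l hjl; fin_cases j <;> fin_cases l <;> first | exact hw | simp at hjl
  · intro j l hjl
    fin_cases j <;> fin_cases l <;>
      first | exact one_dotProduct_lap_mulVec G w | simp at hjl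
  · intro j; fin_cases j
    · change 1 ⬝ᵥ lap G *ᵥ 1 ≤ _ * ((1 : Fin n → ℝ) ⬝ᵥ 1)
      rw [one_dotProduct_lap_mulVec, one_dotProduct_one_real]
      have := dotProduct_lap_mulVec_self_nonneg G w
      positivity
    · change w ⬝ᵥ lap G *ᵥ w ≤ _ * (w ⬝ᵥ w)
      rw [div_mul_cancel₀ _ hpos.ne']

/-- The second smallest positive eigenvalue bounds the Rayleigh quotient on the complement of the
constants and of an eigenvector for the algebraic connectivity. -/
theorem lamLap_mul_le_of_orthogonal_pair (hn : 3 ≤ n) {v w : Fin n → ℝ} (hv0 : v ≠ 0)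
    (hv1 : 1 ⬝ᵥ v = 0) (hv : lap G *ᵥ v = lamLap G (n - 1) • v) (hw : 1 ⬝ᵥ w = 0)
    (hvw : v ⬝ᵥ w = 0) : lamLap G (n - 2) * (w ⬝ᵥ w) ≤ w ⬝ᵥ lap G *ᵥ w := by
  by_cases hw0 : w = 0
  · simp [hw0]
  have hpos := dotProduct_self_pos hw0
  have hvw' : v ⬝ᵥ lap G *ᵥ w = 0 := by
    rw [dotProduct_lap_mulVec_comm, hv, dotProduct_smul, dotProduct_comm, hvw, smul_zero]
  rw [← le_div_iff₀ hpos]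
  refine lamLap_le_of_family (by omega) (by omega) ![1, v, w] ?_ ?_ ?_ (by omega) ?_
  · intro j; fin_cases j
    · exact one_ne_zero_of_two_le (by omega)
    · exact hv0
    · exact hw0
  · intro j l hjl
    fin_cases j <;> fin_cases l <;> first | exact hw | exact hv1 | exact hvw | simp at hjl
  · intro j l hjl
    fin_cases j <;> fin_cases l <;>
      first | exact hvw' | exact one_dotProduct_lap_mulVec G _ | simp at hjl
  · intro j; fin_cases j
    · change 1 ⬝ᵥ lap G *ᵥ 1 ≤ _ * ((1 : Fin n → ℝ) ⬝ᵥ 1)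
      rw [one_dotProduct_lap_mulVec, one_dotProduct_one_real]
      have := dotProduct_lap_mulVec_self_nonneg G w
      positivity
    · change v ⬝ᵥ lap G *ᵥ v ≤ _ * (v ⬝ᵥ v)
      rw [hv, dotProduct_smul, smul_eq_mul]
      refine mul_le_mul_of_nonneg_right ?_ (dotProduct_self_pos hv0).le
      rw [le_div_iff₀ hpos]
      exact lamLap_mul_le_of_orthogonal_one (by omega) hw
    · change w ⬝ᵥ lap G *ᵥ w ≤ _ * (w ⬝ᵥ w)
      rw [div_mul_cancel₀ _ hpos.ne']

/-- The orthogonal complement of the constant vectors. -/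
noncomputable def onesCompl (n : ℕ) : Submodule ℝ (EuclideanSpace ℝ (Fin n)) :=
  (Submodule.span ℝ {WithLp.toLp 2 (1 : Fin n → ℝ)})ᗮ

theorem one_dotProduct_of_mem_onesCompl {w : EuclideanSpace ℝ (Fin n)} (hw : w ∈ onesCompl n) :
    1 ⬝ᵥ w.ofLp = 0 := by
  have := Submodule.mem_orthogonal_singleton_iff_inner_right.1 hw
  rwa [← WithLp.toLp_ofLp 2 w, inner_toLp_toLp_real] at this

theorem finrank_onesCompl (hn : 2 ≤ n) : Module.finrank ℝ (onesCompl n) + 1 = n := by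
  have h := Submodule.finrank_add_finrank_orthogonal
    (Submodule.span ℝ {WithLp.toLp 2 (1 : Fin n → ℝ)})
  rw [finrank_span_singleton (by simpa using one_ne_zero_of_two_le hn)] at h
  simp only [finrank_euclideanSpace, Fintype.card_fin] at h
  rw [add_comm]; exact h

theorem le_lamLap_of_forall_orthogonal_one (hn : 2 ≤ n) {c : ℝ}
    (h : ∀ w : Fin n → ℝ, 1 ⬝ᵥ w = 0 → c * (w ⬝ᵥ w) ≤ w ⬝ᵥ lap G *ᵥ w) :
    c ≤ lamLap G (n - 1) := by
  rw [lamLap, dif_pos ⟨by omega, by omega⟩]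
  refine LinearMap.IsSymmetric.le_eigenvalues_of_submodule _ _ _ (onesCompl n) ?_ ?_
  · have := finrank_onesCompl hn
    simp only; omega
  · intro w hw
    have := h _ (one_dotProduct_of_mem_onesCompl hw)
    rwa [← inner_toEuclideanLin_toLp, ← norm_sq_toLp] at this

theorem lamLap_anti {k l : ℕ} (hk : 1 ≤ k) (hkl : k ≤ l) (hl : l ≤ n) :
    lamLap G l ≤ lamLap G k := by
  rw [lamLap, lamLap, dif_pos ⟨by omega, by omega⟩, dif_pos ⟨by omega, by omega⟩]
  apply (lap_isHermitian G).eigenvalues₀_antitone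
  simp only [Fin.mk_le_mk]; omega

theorem eq_of_dotProduct_lap_mulVec_self_nonpos (hG : G.Connected) {w : Fin n → ℝ}
    (hw : w ⬝ᵥ lap G *ᵥ w ≤ 0) (i j : Fin n) : w i = w j := by
  classical
  have h0 := le_antisymm hw (dotProduct_lap_mulVec_self_nonneg G w)
  unfold lap at h0
  rw [← Matrix.toLinearMap₂'_apply'] at h0
  exact (SimpleGraph.lapMatrix_toLinearMap₂'_apply'_eq_zero_iff_forall_reachable G w).1 h0 i j
    (hG.preconnected i j)

/-- A connected graph has positive algebraic connectivity. -/
theorem lamLap_pos_of_connected (hn : 2 ≤ n) (hG : G.Connected) : 0 < lamLap G (n - 1) := by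
  by_contra! hle
  have hle0 := (lamLap_anti (G := G) (k := n - 1) (l := n) (by omega) (by omega) le_rfl).trans hle
  let b := (isSymmetric_toEuclideanLin_iff.mpr (lap_isHermitian G)).eigenvectorBasis
    finrank_euclideanSpace
  -- If `λ_{n-1} ≤ 0`, then the last two eigenvectors are both constant on a connected graph, hence
  -- nonzero multiples of `1`, which contradicts their orthogonality.
  have key : ∀ k : Fin (Fintype.card (Fin n)), (lap_isHermitian G).eigenvalues₀ k ≤ 0 →
      ∀ i j, (b k).ofLp i = (b k).ofLp j := by
    intro k hk
    refine eq_of_dotProduct_lap_mulVec_self_nonpos hG ?_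
    rw [← inner_toEuclideanLin_toLp, WithLp.toLp_ofLp, LinearMap.IsSymmetric.apply_eigenvectorBasis,
      inner_smul_left, real_inner_self_eq_norm_sq]
    exact mul_nonpos_of_nonpos_of_nonneg hk (sq_nonneg _)
  rw [lamLap, dif_pos ⟨by omega, by omega⟩] at hle hle0
  have h1 := key _ hle
  have h2 := key _ hle0
  set k₁ : Fin (Fintype.card (Fin n)) := ⟨n - 1 - 1, by simp; omega⟩
  set k₂ : Fin (Fintype.card (Fin n)) := ⟨n - 1, by simp; omega⟩
  have hne : k₁ ≠ k₂ := by simp [k₁, k₂]; omega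
  have hort : inner ℝ (b k₁) (b k₂) = 0 := b.orthonormal.2 hne
  let i₀ : Fin n := ⟨0, by omega⟩
  have hconst : ∀ k, (∀ i j, (b k).ofLp i = (b k).ofLp j) →
      b k = (b k).ofLp i₀ • WithLp.toLp 2 (1 : Fin n → ℝ) := by
    intro k hk
    ext i
    simpa using hk i i₀
  have hnz : ∀ k, (∀ i j, (b k).ofLp i = (b k).ofLp j) → (b k).ofLp i₀ ≠ 0 := by
    intro k hk h0
    have := hconst k hk
    rw [h0, zero_smul] at this
    exact b.orthonormal.ne_zero k this
  rw [hconst _ h1, hconst _ h2, inner_smul_left, inner_smul_right, inner_toLp_toLp_real,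
    one_dotProduct_one_real] at hort
  have hn0 : (n : ℝ) ≠ 0 := by positivity
  simp [hnz _ h1, hnz _ h2] at hort
  omega

end Laplacian

/-! ### Contraction and second singular value of the weight matrix. -/

section WeightMatrix

open Matrix

variable {n : ℕ} (G : SimpleGraph (Fin n))

open scoped Classical in
theorem lap_apply (i j : Fin n) :
    lap G i j = (if i = j then (G.degree i : ℝ) else 0) - if G.Adj i j then 1 else 0 := by
  simp [lap, SimpleGraph.lapMatrix, SimpleGraph.degMatrix, Matrix.diagonal_apply]

open scoped Classical in
theorem lap_apply_self (i : Fin n) : lap G i i = G.degree i := by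
  simp [lap_apply]

open scoped Classical in
theorem sum_adj_eq_lap_apply_self (i : Fin n) :
    ∑ j, (if G.Adj i j then (1 : ℝ) else 0) = lap G i i := by
  rw [lap_apply_self, SimpleGraph.degree_eq_sum_if_adj]

theorem lap_apply_nonpos {i j : Fin n} (hij : i ≠ j) : lap G i j ≤ 0 := by
  classical
  rw [lap_apply, if_neg hij]
  split_ifs <;> norm_num

/-- From `(a - b)² ≤ 2 a² + 2 b²` on each edge. Because of this bound the factor `2 (1 + d)` makes
the weight matrix positive semidefinite, so no negative eigenvalue can affect `σ₂`. -/
theorem dotProduct_lap_mulVec_self_le {d : ℝ} (hd : ∀ i, lap G i i ≤ d) (w : Fin n → ℝ) :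
    w ⬝ᵥ lap G *ᵥ w ≤ 2 * d * (w ⬝ᵥ w) := by
  classical
  let a : Fin n → Fin n → ℝ := fun i j => if G.Adj i j then 1 else 0
  have hsymm : ∀ i j, a i j = a j i := fun i j => by simp [a, G.adj_comm]
  have h1 : ∑ i, ∑ j, a i j * w i ^ 2 ≤ d * (w ⬝ᵥ w) := by
    rw [dotProduct, Finset.mul_sum]
    refine Finset.sum_le_sum fun i _ => ?_
    rw [← Finset.sum_mul, sum_adj_eq_lap_apply_self, ← sq]
    exact mul_le_mul_of_nonneg_right (hd i) (sq_nonneg _)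
  have h2 : ∑ i, ∑ j, a i j * w j ^ 2 = ∑ i, ∑ j, a i j * w i ^ 2 := by
    rw [Finset.sum_comm]
    exact Finset.sum_congr rfl fun i _ => Finset.sum_congr rfl fun j _ => by rw [hsymm]
  have h3 : ∑ i, ∑ j, (if G.Adj i j then (w i - w j) ^ 2 else 0)
      ≤ ∑ i, ∑ j, (2 * (a i j * w i ^ 2) + 2 * (a i j * w j ^ 2)) := by
    refine Finset.sum_le_sum fun i _ => Finset.sum_le_sum fun j _ => ?_
    simp only [a]
    split_ifs
    · nlinarith [sq_nonneg (w i + w j)]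
    · simp
  simp only [Finset.sum_add_distrib, ← Finset.mul_sum, h2] at h3
  rw [dotProduct_lap_mulVec_self]
  linarith

/-- The weight matrix `I - L / (2 (1 + d))` of a graph with Laplacian `L`. -/
noncomputable def weightMatrix (d : ℝ) : Matrix (Fin n) (Fin n) ℝ :=
  1 - (1 / (2 * (1 + d))) • lap G

/-- The contraction factor `1 - λ / (2 (1 + d))` of the weight matrix of a graph with algebraic
connectivity `λ`. -/
noncomputable def weightRate (d : ℝ) : ℝ :=
  1 - lamLap G (n - 1) / (2 * (1 + d))

variable {G} {d : ℝ}

theorem weightMatrix_mulVec (w : Fin n → ℝ) :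
    weightMatrix G d *ᵥ w = w - (1 / (2 * (1 + d))) • lap G *ᵥ w := by
  rw [weightMatrix, sub_mulVec, one_mulVec, smul_mulVec]

theorem weightMatrix_mulVec_one : weightMatrix G d *ᵥ 1 = 1 := by
  rw [weightMatrix_mulVec, lap_mulVec_one, smul_zero, sub_zero]

theorem weightMatrix_isHermitian : (weightMatrix G d).IsHermitian := by
  have hL : (lap G)ᵀ = lap G := by simpa [Matrix.IsHermitian] using lap_isHermitian G
  simp [Matrix.IsHermitian, weightMatrix, hL]

theorem one_dotProduct_weightMatrix_mulVec (w : Fin n → ℝ) :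
    1 ⬝ᵥ weightMatrix G d *ᵥ w = 1 ⬝ᵥ w := by
  rw [dotProduct_mulVec_comm weightMatrix_isHermitian, weightMatrix_mulVec_one, dotProduct_comm]

theorem dotProduct_weightMatrix_mulVec_self (w : Fin n → ℝ) :
    w ⬝ᵥ weightMatrix G d *ᵥ w = w ⬝ᵥ w - (w ⬝ᵥ lap G *ᵥ w) / (2 * (1 + d)) := by
  rw [weightMatrix_mulVec, dotProduct_sub, dotProduct_smul, smul_eq_mul]
  ring

theorem weightMatrix_apply_nonneg (hd0 : 0 ≤ d) (hd : ∀ i, lap G i i ≤ d) (i j : Fin n) :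
    0 ≤ weightMatrix G d i j := by
  rw [weightMatrix, Matrix.sub_apply, Matrix.smul_apply, smul_eq_mul]
  by_cases hij : i = j
  · subst hij
    rw [Matrix.one_apply_eq, one_div_mul_eq_div, sub_nonneg, div_le_one (by positivity)]
    linarith [hd i]
  · rw [Matrix.one_apply_ne hij, zero_sub, neg_nonneg]
    exact mul_nonpos_of_nonneg_of_nonpos (by positivity) (lap_apply_nonpos G hij)

theorem dotProduct_weightMatrix_mulVec_self_nonneg (hd0 : 0 ≤ d) (hd : ∀ i, lap G i i ≤ d)
    (w : Fin n → ℝ) : 0 ≤ w ⬝ᵥ weightMatrix G d *ᵥ w := by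
  rw [dotProduct_weightMatrix_mulVec_self, sub_nonneg, div_le_iff₀ (by positivity)]
  have h0 : 0 ≤ w ⬝ᵥ w := Finset.sum_nonneg fun i _ => mul_self_nonneg (w i)
  nlinarith [dotProduct_lap_mulVec_self_le G hd w]

theorem dotProduct_weightMatrix_mulVec_self_le (hn : 2 ≤ n) (hd0 : 0 ≤ d) {w : Fin n → ℝ}
    (hw : 1 ⬝ᵥ w = 0) : w ⬝ᵥ weightMatrix G d *ᵥ w ≤ weightRate G d * (w ⬝ᵥ w) := by
  rw [dotProduct_weightMatrix_mulVec_self, weightRate, sub_mul, one_mul, div_mul_eq_mul_div]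
  gcongr
  exact lamLap_mul_le_of_orthogonal_one hn hw

/-- Turns the Rayleigh bound into a norm bound without diagonalizing: positivity of the form of `P`
at `s w - P w`, together with the Rayleigh bound at `w` and at `P w`, gives `s ‖P w‖² ≤ s³ ‖w‖²`. -/
theorem weightMatrix_contraction (hn : 2 ≤ n) (hd0 : 0 ≤ d) (hd : ∀ i, lap G i i ≤ d)
    (hs : 0 < weightRate G d) {w : Fin n → ℝ} (hw : 1 ⬝ᵥ w = 0) :
    weightMatrix G d *ᵥ w ⬝ᵥ weightMatrix G d *ᵥ w ≤ weightRate G d ^ 2 * (w ⬝ᵥ w) := by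
  set P := weightMatrix G d
  set s := weightRate G d
  have h1 := dotProduct_weightMatrix_mulVec_self_nonneg hd0 hd (s • w - P *ᵥ w)
  have h2 := dotProduct_weightMatrix_mulVec_self_le (G := G) hn hd0 hw
  have h3 := dotProduct_weightMatrix_mulVec_self_le (G := G) (w := P *ᵥ w) hn hd0
    (by rw [one_dotProduct_weightMatrix_mulVec, hw])
  have h4 : w ⬝ᵥ P *ᵥ (P *ᵥ w) = P *ᵥ w ⬝ᵥ P *ᵥ w :=
    dotProduct_mulVec_comm weightMatrix_isHermitian _ _
  change 0 ≤ (s • w - P *ᵥ w) ⬝ᵥ P *ᵥ (s • w - P *ᵥ w) at h1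
  rw [mulVec_sub, mulVec_smul, sub_dotProduct, dotProduct_sub, dotProduct_sub, smul_dotProduct,
    smul_dotProduct, dotProduct_smul, dotProduct_smul, h4] at h1
  simp only [smul_eq_mul] at h1
  have h5 : s * (P *ᵥ w ⬝ᵥ P *ᵥ w) ≤ s * (s ^ 2 * (w ⬝ᵥ w)) := by
    have := mul_le_mul_of_nonneg_left h2 (sq_nonneg s)
    change P *ᵥ w ⬝ᵥ P *ᵥ (P *ᵥ w) ≤ s * _ at h3
    nlinarith
  exact le_of_mul_le_mul_left h5 hs

/-- The indicator of a node minus its average. -/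
noncomputable def centeredSingle (i : Fin n) : Fin n → ℝ :=
  Pi.single i 1 - (1 / (n : ℝ)) • 1

theorem one_dotProduct_centeredSingle (i : Fin n) : 1 ⬝ᵥ centeredSingle i = 0 := by
  have hn : (n : ℝ) ≠ 0 := by
    have := i.pos
    positivity
  rw [centeredSingle, dotProduct_sub, dotProduct_smul, one_dotProduct_one_real]
  simp [hn]

theorem centeredSingle_dotProduct_self (i : Fin n) :
    centeredSingle i ⬝ᵥ centeredSingle i = 1 - 1 / (n : ℝ) := by
  conv_lhs => rw [centeredSingle, sub_dotProduct, smul_dotProduct, ← centeredSingle,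
    one_dotProduct_centeredSingle]
  simp [centeredSingle]

/-- Testing with a centered indicator gives `λ_{n-1} (1 - 1 / n) ≤ d`, and `d ≤ n - 1` turns this
into `λ_{n-1} ≤ 1 + d`. The lower bound keeps every logarithm below at a positive argument and later
forces `T ≤ 2 ^ δ`. -/
theorem weightRate_ge_half (hn : 2 ≤ n) (hd0 : 0 ≤ d) (hd : ∀ i, lap G i i ≤ d)
    (hdn : d ≤ n - 1) : 1 / 2 ≤ weightRate G d := by
  let i : Fin n := ⟨0, by omega⟩
  have h := lamLap_mul_le_of_orthogonal_one (G := G) hn (one_dotProduct_centeredSingle i)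
  have hq : centeredSingle i ⬝ᵥ lap G *ᵥ centeredSingle i = lap G i i := by
    conv_lhs => rw [centeredSingle, sub_dotProduct, smul_dotProduct, one_dotProduct_lap_mulVec,
      smul_zero, sub_zero, mulVec_sub, mulVec_smul, lap_mulVec_one]
    simp
  rw [centeredSingle_dotProduct_self, hq] at h
  have hn2 : (2 : ℝ) ≤ n := by exact_mod_cast hn
  have h1 : lamLap G (n - 1) * (n - 1) ≤ d * n := by
    have := mul_le_mul_of_nonneg_right (h.trans (hd i)) (by positivity : (0 : ℝ) ≤ n)
    calc _ = lamLap G (n - 1) * (1 - 1 / (n : ℝ)) * n := by field_simp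
      _ ≤ _ := this
  have h2 : lamLap G (n - 1) ≤ 1 + d := by
    refine le_of_mul_le_mul_right (a := (n : ℝ) - 1) ?_ (by linarith)
    nlinarith
  rw [weightRate, le_sub_comm, div_le_iff₀ (by positivity)]
  linarith

theorem toEuclideanLin_adjoint_comp_self_inner (P : Matrix (Fin n) (Fin n) ℝ) (x y : Fin n → ℝ) :
    inner ℝ ((LinearMap.adjoint (toEuclideanLin P) ∘ₗ toEuclideanLin P) (WithLp.toLp 2 x))
      (WithLp.toLp 2 y) = P *ᵥ x ⬝ᵥ P *ᵥ y := by
  rw [LinearMap.comp_apply, LinearMap.adjoint_inner_left, toLpLin_apply, toLpLin_apply,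
    inner_toLp_toLp_real]

/-- The second largest singular value of the weight matrix of a connected graph. -/
theorem sigma2_weightMatrix (hn : 2 ≤ n) (hd0 : 0 ≤ d) (hd : ∀ i, lap G i i ≤ d)
    (hs : 0 < weightRate G d) (hG : G.Connected) {v : Fin n → ℝ} (hv : v ⬝ᵥ v = 1)
    (hLv : lap G *ᵥ v = lamLap G (n - 1) • v) :
    sigma2 (weightMatrix G d) = weightRate G d := by
  have hlam := lamLap_pos_of_connected hn hG
  have hs1 : weightRate G d ≤ 1 := by
    rw [weightRate, sub_le_self_iff]; positivity
  have hv1 : 1 ⬝ᵥ v = 0 := by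
    have h := one_dotProduct_lap_mulVec G v
    rw [hLv, dotProduct_smul, smul_eq_mul] at h
    exact (mul_eq_zero.1 h).resolve_left hlam.ne'
  have hPv : weightMatrix G d *ᵥ v = weightRate G d • v := by
    rw [weightMatrix_mulVec, hLv, weightRate, sub_smul, one_smul, smul_smul]
    congr 2; ring
  have hcard : 1 < Fintype.card (Fin n) := by simp; omega
  have hsq := (toEuclideanLin (weightMatrix G d)).sq_singularValues_of_lt
    finrank_euclideanSpace hcard
  -- Upper bound: `PᵀP` is at most `s²` on the complement of `1`, a subspace of codimension one.
  have hle : sigma2 (weightMatrix G d) ^ 2 ≤ weightRate G d ^ 2 := by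
    rw [sigma2, hsq]
    refine LinearMap.IsSymmetric.eigenvalues_le_of_submodule _ _ _ (onesCompl n) ?_ ?_
    · have := finrank_onesCompl hn
      simp only [Fintype.card_fin]; omega
    · intro w hw
      rw [← WithLp.toLp_ofLp 2 w, toEuclideanLin_adjoint_comp_self_inner, norm_sq_toLp]
      exact weightMatrix_contraction hn hd0 hd hs (one_dotProduct_of_mem_onesCompl hw)
  -- Lower bound: `PᵀP` is at least `s²` on the plane spanned by `1` and `v`.
  have hge : weightRate G d ^ 2 ≤ sigma2 (weightMatrix G d) ^ 2 := by
    have hP1 := weightMatrix_mulVec_one (G := G) (d := d)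
    rw [sigma2, hsq]
    refine LinearMap.IsSymmetric.le_eigenvalues_of_family _ _ _
      (![WithLp.toLp 2 (1 : Fin n → ℝ), WithLp.toLp 2 v]) ?_ ?_ ?_ (m := 2) (by simp) ?_
    · intro j; fin_cases j
      · simpa using one_ne_zero_of_two_le hn
      · intro h
        have : v = 0 := by simpa using h
        simp [this] at hv
    · intro j l hjl
      fin_cases j <;> fin_cases l <;> first | exact absurd rfl hjl | skip
      · exact (inner_toLp_toLp_real _ _).trans hv1
      · exact (inner_toLp_toLp_real _ _).trans ((dotProduct_comm _ _).trans hv1)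
    · intro j l hjl
      fin_cases j <;> fin_cases l <;> first | exact absurd rfl hjl | skip
      · refine (toEuclideanLin_adjoint_comp_self_inner _ _ _).trans ?_
        rw [hP1, hPv, dotProduct_smul, hv1, smul_zero]
      · refine (toEuclideanLin_adjoint_comp_self_inner _ _ _).trans ?_
        rw [hP1, hPv, smul_dotProduct, dotProduct_comm, hv1, smul_zero]
    · intro j; fin_cases j
      · refine le_of_le_of_eq ?_ (toEuclideanLin_adjoint_comp_self_inner _ _ _).symm
        change _ * ‖WithLp.toLp 2 (1 : Fin n → ℝ)‖ ^ 2 ≤ _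
        rw [hP1, norm_sq_toLp, one_dotProduct_one_real]
        refine mul_le_of_le_one_left (by positivity) ?_
        exact pow_le_one₀ hs.le hs1
      · refine le_of_eq_of_le ?_ (toEuclideanLin_adjoint_comp_self_inner _ _ _).ge
        change _ * ‖WithLp.toLp 2 v‖ ^ 2 = _
        rw [hPv, norm_sq_toLp, smul_dotProduct, dotProduct_smul]
        simp only [smul_eq_mul]; ring
  exact (sq_eq_sq₀ (LinearMap.singularValues_nonneg _ _) hs.le).1 (le_antisymm hle hge)

end WeightMatrix

/-! ### Growth of the algebraic connectivity under an added edge. -/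

section SpectralGain

open Matrix

variable {n : ℕ}

theorem edgeVec_dotProduct_self {l : Fin n × Fin n} (hl : l.1 ≠ l.2) :
    edgeVec l ⬝ᵥ edgeVec l = 2 := by
  simp [edgeVec, hl, hl.symm]; norm_num

theorem one_dotProduct_edgeVec (l : Fin n × Fin n) : 1 ⬝ᵥ edgeVec l = 0 := by
  simp [edgeVec, dotProduct_sub]

theorem dotProduct_sq_le (x y : Fin n → ℝ) : (x ⬝ᵥ y) ^ 2 ≤ (x ⬝ᵥ x) * (y ⬝ᵥ y) := by
  simpa [dotProduct, sq] using Finset.sum_mul_sq_le_sq_mul_sq Finset.univ x y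

/-- The test vector is `s v + y` with `Y = ‖y‖²`, `p = a ⬝ᵥ v` and `r = a ⬝ᵥ y`; both bounds by `2`
come from `‖a‖² = 2`. Writing `s p = (s p + r) - r`, the cross term is absorbed by completing the
square `(6 (s p + r) + g r)²`. -/
theorem gain_scalar_bound {g p r s Y : ℝ} (hg : 0 ≤ g) (hY : 0 ≤ Y) (hp : p ^ 2 ≤ 2)
    (hr : r ^ 2 ≤ 2 * Y) :
    p ^ 2 * g * (s ^ 2 + Y) ≤ (g + 6) * (g * Y + (s * p + r) ^ 2) := by
  have h1 := mul_nonneg (mul_nonneg hg hY) (sub_nonneg.2 hp)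
  have h2 := mul_nonneg hg (sub_nonneg.2 hr)
  have h3 := mul_nonneg (mul_nonneg hg hg) (sub_nonneg.2 hr)
  have h4 := mul_nonneg (mul_nonneg hg hg) hY
  have h5 := mul_nonneg hg hY
  nlinarith [sq_nonneg (6 * (s * p + r) + g * r)]

/-- The growth of the algebraic connectivity under an added edge. -/
theorem lamLap_add_le_of_edge (hn : 3 ≤ n) {G G' : SimpleGraph (Fin n)} {l : Fin n × Fin n}
    (hl : l.1 ≠ l.2)
    (hG' : ∀ w, w ⬝ᵥ lap G' *ᵥ w = w ⬝ᵥ lap G *ᵥ w + (edgeVec l ⬝ᵥ w) ^ 2)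
    {v : Fin n → ℝ} (hv : v ⬝ᵥ v = 1) (hv1 : 1 ⬝ᵥ v = 0)
    (hLv : lap G *ᵥ v = lamLap G (n - 1) • v) {g : ℝ}
    (hg : g = lamLap G (n - 2) - lamLap G (n - 1)) :
    lamLap G (n - 1) + (edgeVec l ⬝ᵥ v) ^ 2 * g / (g + 6) ≤ lamLap G' (n - 1) := by
  have hg0 : 0 ≤ g := by
    rw [hg, sub_nonneg]
    exact lamLap_anti (by omega) (by omega) (by omega)
  have hv0 : v ≠ 0 := by rintro rfl; simp at hv
  refine le_lamLap_of_forall_orthogonal_one (by omega) fun w hw => ?_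
  set a := edgeVec l
  have haa : a ⬝ᵥ a = 2 := edgeVec_dotProduct_self hl
  set s := v ⬝ᵥ w
  -- Off `v`, the old form is at least `λ_{n-1} + g`; the edge term can cancel the component along
  -- `v` only if `y` is large, and then the gap pays for it.
  obtain ⟨y, hy⟩ : ∃ y, y = w - s • v := ⟨_, rfl⟩
  have hwy : w = s • v + y := by rw [hy]; simp
  have hvy : v ⬝ᵥ y = 0 := by
    rw [hy, dotProduct_sub, dotProduct_smul, hv]; simp [s]
  have hy1 : 1 ⬝ᵥ y = 0 := by rw [hy, dotProduct_sub, dotProduct_smul, hv1, hw]; simp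
  have hvLy : v ⬝ᵥ lap G *ᵥ y = 0 := by
    rw [dotProduct_lap_mulVec_comm, hLv, dotProduct_smul, dotProduct_comm, hvy, smul_zero]
  have hyy : 0 ≤ y ⬝ᵥ y := Finset.sum_nonneg fun i _ => mul_self_nonneg (y i)
  have hyv : y ⬝ᵥ v = 0 := by rw [dotProduct_comm, hvy]
  have hww : w ⬝ᵥ w = s ^ 2 + y ⬝ᵥ y := by
    rw [hwy]
    simp only [dotProduct_add, add_dotProduct, dotProduct_smul, smul_dotProduct, hv, hvy, hyv,
      smul_eq_mul]
    ring
  have hq : w ⬝ᵥ lap G *ᵥ w = lamLap G (n - 1) * s ^ 2 + y ⬝ᵥ lap G *ᵥ y := by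
    rw [hwy]
    simp only [mulVec_add, mulVec_smul, dotProduct_add, add_dotProduct, dotProduct_smul,
      smul_dotProduct, hvLy, hLv, hv, hyv, smul_eq_mul]
    ring
  have haw : a ⬝ᵥ w = s * (a ⬝ᵥ v) + a ⬝ᵥ y := by
    rw [hwy, dotProduct_add, dotProduct_smul, smul_eq_mul]
  have hy2 := lamLap_mul_le_of_orthogonal_pair hn hv0 hv1 hLv hy1 hvy
  have hp : (a ⬝ᵥ v) ^ 2 ≤ 2 := by
    have := dotProduct_sq_le a v
    rwa [haa, hv, mul_one] at this
  have hr : (a ⬝ᵥ y) ^ 2 ≤ 2 * (y ⬝ᵥ y) := by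
    have := dotProduct_sq_le a y
    rwa [haa] at this
  have key := gain_scalar_bound (s := s) hg0 hyy hp hr
  have key' : (a ⬝ᵥ v) ^ 2 * g / (g + 6) * (s ^ 2 + y ⬝ᵥ y)
      ≤ g * (y ⬝ᵥ y) + (s * (a ⬝ᵥ v) + a ⬝ᵥ y) ^ 2 := by
    rw [div_mul_eq_mul_div, div_le_iff₀ (by positivity)]
    linarith
  rw [hG', hq, hww, haw]
  rw [hg] at key' ⊢
  nlinarith

end SpectralGain

/-! ### Contraction rates along the network and the mixing time problem. -/

namespace EvolvingNetwork

open Matrix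

variable {n T : ℕ} (N : EvolvingNetwork n T)

/-- The contraction factor of `P t` on the complement of the constants. -/
noncomputable def rate (t : ℕ) : ℝ := weightRate (N.G t) N.degMax

theorem P_eq_weightMatrix (t : ℕ) : N.P t = weightMatrix (N.G t) N.degMax := rfl

theorem lap_apply_self_le_degMax {t : ℕ} (ht : t ≤ T) (i : Fin n) :
    lap (N.G t) i i ≤ N.degMax := by
  classical
  rw [lap_apply_self]
  refine Nat.cast_le.2 (((N.G t).degree_le_maxDegree i).trans ?_)
  rw [degMax]
  convert Finset.le_sup (f := fun t => (N.G t).maxDegree) (Finset.mem_range.2 (Nat.lt_succ_of_le ht))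

theorem degMax_le (hn : 2 ≤ n) : (N.degMax : ℝ) ≤ n - 1 := by
  classical
  have h : N.degMax ≤ n - 1 := by
    rw [degMax]
    refine Finset.sup_le fun t _ => ?_
    have : Nonempty (Fin n) := ⟨⟨0, by omega⟩⟩
    have := (N.G t).maxDegree_lt_card_verts
    rw [Fintype.card_fin] at this
    omega
  calc (N.degMax : ℝ) ≤ ((n - 1 : ℕ) : ℝ) := Nat.cast_le.2 h
    _ = n - 1 := by rw [Nat.cast_sub (by omega), Nat.cast_one]

theorem half_le_rate (hn : 2 ≤ n) {t : ℕ} (ht : t ≤ T) : 1 / 2 ≤ N.rate t :=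
  weightRate_ge_half hn (Nat.cast_nonneg _) (N.lap_apply_self_le_degMax ht) (N.degMax_le hn)

theorem dotProduct_lap_succ (t : ℕ) (w : Fin n → ℝ) :
    w ⬝ᵥ lap (N.G (t + 1)) *ᵥ w
      = w ⬝ᵥ lap (N.G t) *ᵥ w + N.u (t + 1) * (edgeVec (N.l (t + 1)) ⬝ᵥ w) ^ 2 := by
  rw [N.step (t + 1) (by omega), Nat.add_sub_cancel, add_mulVec, dotProduct_add, smul_mulVec,
    dotProduct_smul, vecMulVec_mulVec]
  simp [dotProduct_comm w]; ring_nf; simp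

theorem u_nonneg (t : ℕ) : 0 ≤ N.u t := by
  rcases N.u_binary t with h | h <;> simp [h]

theorem lamLap_le_succ (hn : 2 ≤ n) (t : ℕ) :
    lamLap (N.G t) (n - 1) ≤ lamLap (N.G (t + 1)) (n - 1) := by
  refine le_lamLap_of_forall_orthogonal_one hn fun w hw => ?_
  rw [dotProduct_lap_succ]
  have := mul_nonneg (N.u_nonneg (t + 1)) (sq_nonneg (edgeVec (N.l (t + 1)) ⬝ᵥ w))
  linarith [lamLap_mul_le_of_orthogonal_one (G := N.G t) hn hw]

theorem lamLap_pos (hn : 2 ≤ n) (t : ℕ) : 0 < lamLap (N.G t) (n - 1) := by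
  induction t with
  | zero => exact lamLap_pos_of_connected hn N.connected
  | succ t ih => exact ih.trans_le (N.lamLap_le_succ hn t)

theorem rate_antitone (hn : 2 ≤ n) : Antitone N.rate := by
  refine antitone_nat_of_succ_le fun t => ?_
  unfold rate weightRate
  gcongr
  exact N.lamLap_le_succ hn t

theorem rate_lt_one (hn : 2 ≤ n) (t : ℕ) : N.rate t < 1 := by
  unfold rate weightRate
  have := N.lamLap_pos hn t
  rw [sub_lt_self_iff]
  positivity

/-- A network on two nodes is complete from the start. -/
theorem u_succ_eq_zero_of_two (hn : n = 2) (t : ℕ) : N.u (t + 1) = 0 := by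
  classical
  refine (N.u_binary (t + 1)).resolve_right fun hu => ?_
  obtain ⟨hne, hadj⟩ := N.l_new (t + 1) (by omega) hu
  rw [Nat.add_sub_cancel] at hadj
  have h := lamLap_mul_le_of_orthogonal_one (G := N.G t) hn.ge
    (one_dotProduct_edgeVec (N.l (t + 1)))
  have hpos := N.lamLap_pos hn.ge t
  rw [edgeVec_dotProduct_self hne, dotProduct_lap_mulVec_self] at h
  have hno : ∀ i j, ¬ (N.G t).Adj i j := by
    intro i j hij
    have hij' := hij.ne
    subst hn
    have : (i = (N.l (t + 1)).1 ∧ j = (N.l (t + 1)).2) ∨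
        (i = (N.l (t + 1)).2 ∧ j = (N.l (t + 1)).1) := by
      generalize (N.l (t + 1)).1 = x at *
      generalize (N.l (t + 1)).2 = y at *
      omega
    rcases this with ⟨rfl, rfl⟩ | ⟨rfl, rfl⟩
    · exact hadj hij
    · exact hadj hij.symm
  simp [hno] at h
  linarith

variable {N} {v : ℕ → Fin n → ℝ}

theorem one_dotProduct_eigenvector (hn : 2 ≤ n) (hv : N.IsConnectivityEigenvector v) {t : ℕ}
    (ht : t ≤ T) : 1 ⬝ᵥ v t = 0 := by
  have h := one_dotProduct_lap_mulVec (N.G t) (v t)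
  rw [(hv t ht).2, dotProduct_smul, smul_eq_mul] at h
  exact (mul_eq_zero.1 h).resolve_left (N.lamLap_pos hn t).ne'

/-- An added edge improves the contraction factor by the guaranteed amount. -/
theorem rate_succ_le (hn : 2 ≤ n) (hv : N.IsConnectivityEigenvector v) {t : ℕ} (ht : t < T) :
    0 ≤ N.u (t + 1) * N.b t * (edgeVec (N.l (t + 1)) ⬝ᵥ v t) ^ 2 ∧
      N.rate (t + 1) ≤ N.rate t - N.u (t + 1) * N.b t * (edgeVec (N.l (t + 1)) ⬝ᵥ v t) ^ 2 := by
  have hmono := N.rate_antitone hn (Nat.le_succ t)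
  rcases N.u_binary (t + 1) with hu | hu
  · simpa [hu] using hmono
  -- For `n = 2` the eigenvalue `λ_{n-2}` does not exist and `gap` would use the default value of
  -- `lamLap` at `0`; but then no edge can be added.
  have hn3 : 3 ≤ n := by
    by_contra h
    have := N.u_succ_eq_zero_of_two (by omega) t
    rw [hu] at this
    exact one_ne_zero this
  have hg0 : 0 ≤ N.gap t := by
    rw [gap, sub_nonneg]
    exact lamLap_anti (by omega) (by omega) (by omega)
  have hb0 : 0 ≤ N.b t := by
    unfold b
    split_ifs <;> positivity
  refine ⟨by rw [hu]; positivity, ?_⟩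
  by_cases hg : N.gap t = 0
  · simpa [b, hg] using hmono
  have hgpos : 0 < N.gap t := hg0.lt_of_ne' hg
  obtain ⟨hv1, hLv⟩ := hv t ht.le
  have hgain := lamLap_add_le_of_edge hn3 (G := N.G t) (G' := N.G (t + 1)) (l := N.l (t + 1))
    (N.l_new (t + 1) (by omega) hu).1
    (fun w => by rw [dotProduct_lap_succ, hu, one_mul]) hv1
    (one_dotProduct_eigenvector hn hv ht.le) hLv (g := N.gap t) rfl
  have hd : (0 : ℝ) < 2 * (1 + N.degMax) := by positivity
  -- Here `b t = g / (2 (1 + δ_max) (g + 6))`, exactly the gain in `λ_{n-1}` rescaled to the rate.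
  have hbe : N.u (t + 1) * N.b t * (edgeVec (N.l (t + 1)) ⬝ᵥ v t) ^ 2
      = ((edgeVec (N.l (t + 1)) ⬝ᵥ v t) ^ 2 * N.gap t / (N.gap t + 6)) / (2 * (1 + N.degMax)) := by
    rw [hu, b, if_neg hg]
    field_simp
    ring
  rw [hbe, rate, rate, weightRate, weightRate, sub_sub, ← add_div]
  gcongr

theorem decrease_zero : N.decrease v 0 = 0 := by simp [decrease]

theorem decrease_succ (k : ℕ) : N.decrease v (k + 1) = N.decrease v k
    + N.u (k + 1) * N.b k * (edgeVec (N.l (k + 1)) ⬝ᵥ v k) ^ 2 := by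
  rw [decrease, decrease, Finset.sum_Icc_succ_top (by omega), Nat.add_sub_cancel]

theorem rate_le_sub_decrease (hn : 2 ≤ n) (hv : N.IsConnectivityEigenvector v) {k : ℕ}
    (hk : k ≤ T) : 0 ≤ N.decrease v k ∧ N.rate k ≤ N.rate 0 - N.decrease v k := by
  induction k with
  | zero => simp [decrease_zero]
  | succ k ih =>
    obtain ⟨h1, h2⟩ := ih (by omega)
    obtain ⟨h3, h4⟩ := rate_succ_le hn hv (t := k) (by omega)
    rw [decrease_succ]
    exact ⟨by linarith, by linarith⟩

/-- All `k` are needed, since a feasible `δ` may exceed `T`; beyond `T` no edge is added and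
`decrease` is constant. -/
theorem decrease_bounds (hn : 2 ≤ n) (hv : N.IsConnectivityEigenvector v) (k : ℕ) :
    0 ≤ N.decrease v k ∧ 1 / 2 ≤ N.rate 0 - N.decrease v k := by
  have hle : ∀ j ≤ T, 0 ≤ N.decrease v j ∧ 1 / 2 ≤ N.rate 0 - N.decrease v j := fun j hj =>
    ⟨(rate_le_sub_decrease hn hv hj).1,
      (N.half_le_rate hn hj).trans (rate_le_sub_decrease hn hv hj).2⟩
  induction k with
  | zero => exact hle 0 (Nat.zero_le _)
  | succ k ih =>
    rcases Nat.lt_or_ge T (k + 1) with h | h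
    · rwa [decrease_succ, N.u_after _ h, zero_mul, zero_mul, add_zero]
    · exact hle _ h

theorem sigma2_P_zero (hn : 2 ≤ n) (hv : N.IsConnectivityEigenvector v) :
    sigma2 (N.P 0) = N.rate 0 :=
  sigma2_weightMatrix hn (Nat.cast_nonneg _) (N.lap_apply_self_le_degMax (Nat.zero_le _))
    (lt_of_lt_of_le one_half_pos (N.half_le_rate hn (Nat.zero_le _))) N.connected
    (hv 0 (Nat.zero_le _)).1 (hv 0 (Nat.zero_le _)).2

variable (N v) in
/-- The guaranteed contraction over a window of `m` time steps. -/
noncomputable def windowBound (m : ℕ) : ℝ := ∏ k ∈ Finset.range m, (N.rate 0 - N.decrease v k)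

theorem windowBound_pos (hn : 2 ≤ n) (hv : N.IsConnectivityEigenvector v) (m : ℕ) :
    0 < N.windowBound v m :=
  Finset.prod_pos fun k _ => lt_of_lt_of_le one_half_pos (decrease_bounds hn hv k).2

theorem half_pow_le_windowBound (hn : 2 ≤ n) (hv : N.IsConnectivityEigenvector v) (m : ℕ) :
    (1 / 2) ^ m ≤ N.windowBound v m := by
  rw [windowBound, ← Finset.card_range m, ← Finset.prod_const, Finset.card_range]
  exact Finset.prod_le_prod (fun _ _ => by norm_num) fun k _ => (decrease_bounds hn hv k).2

theorem windowBound_le_pow (hn : 2 ≤ n) (hv : N.IsConnectivityEigenvector v) (m : ℕ) :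
    N.windowBound v m ≤ N.rate 0 ^ m := by
  rw [windowBound, ← Finset.card_range m, ← Finset.prod_const, Finset.card_range]
  refine Finset.prod_le_prod (fun k _ => ?_) fun k _ => ?_
  · linarith [(decrease_bounds hn hv k).2]
  · linarith [(decrease_bounds hn hv k).1]

theorem windowBound_antitone (hn : 2 ≤ n) (hv : N.IsConnectivityEigenvector v) :
    Antitone (N.windowBound v) := by
  refine antitone_nat_of_succ_le fun m => ?_
  rw [windowBound, Finset.prod_range_succ]
  refine mul_le_of_le_one_right (windowBound_pos hn hv m).le ?_
  linarith [N.rate_lt_one hn 0, (decrease_bounds hn hv m).1]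

/-- More edges are present in a later window, so rates are smaller there, and the window starting at
time `0` is the worst case. -/
theorem prod_rate_le_windowBound (hn : 2 ≤ n) (hv : N.IsConnectivityEigenvector v) {r m : ℕ}
    (hm : r + m ≤ T) : ∏ k ∈ Finset.range m, N.rate (r + 1 + k) ≤ N.windowBound v m := by
  refine Finset.prod_le_prod (fun k hk => ?_) fun k hk => ?_
  · have := Finset.mem_range.1 hk
    linarith [N.half_le_rate hn (t := r + 1 + k) (by omega)]
  · have := Finset.mem_range.1 hk
    exact (N.rate_antitone hn (by omega)).trans (rate_le_sub_decrease hn hv (by omega)).2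

/-- Each factor is `σ (1 - decrease k / σ)`. The factor for `k = 0` is just `σ`, which is why `m +
1` factors match a sum over `1 ≤ k ≤ m`. -/
theorem log_windowBound (hn : 2 ≤ n) (hv : N.IsConnectivityEigenvector v) (m : ℕ) :
    Real.log (N.windowBound v (m + 1)) = (m + 1 : ℕ) * Real.log (N.rate 0)
      + ∑ k ∈ Finset.Icc 1 m, Real.log (1 - N.decrease v k / N.rate 0) := by
  have hs : 0 < N.rate 0 := lt_of_lt_of_le one_half_pos (N.half_le_rate hn (Nat.zero_le _))
  have hf : ∀ k, 0 < N.rate 0 - N.decrease v k := fun k =>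
    lt_of_lt_of_le one_half_pos (decrease_bounds hn hv k).2
  induction m with
  | zero => simp [windowBound, decrease_zero]
  | succ m ih =>
    have hsplit : N.rate 0 - N.decrease v (m + 1)
        = N.rate 0 * (1 - N.decrease v (m + 1) / N.rate 0) := by field_simp
    have hpos : 0 < 1 - N.decrease v (m + 1) / N.rate 0 := by
      have := hf (m + 1)
      rw [hsplit] at this
      exact pos_of_mul_pos_right this hs.le
    rw [windowBound, Finset.prod_range_succ, ← windowBound,
      Real.log_mul (windowBound_pos hn hv _).ne' (hf _).ne', ih, Finset.sum_Icc_succ_top (by omega),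
      hsplit, Real.log_mul hs.ne' hpos.ne']
    push_cast
    ring

/-- The equality constraint fixes `log β` in terms of `δ`, and the inequality multiplied by `log σ⁻¹
> 0` is the logarithm of the right-hand condition. -/
theorem exists_feasible_iff (hn : 2 ≤ n) (hT : 1 ≤ T) (hv : N.IsConnectivityEigenvector v)
    (δ : ℕ) : (∃ β, N.Feasible v β δ) ↔ 1 ≤ δ ∧ T * √n * N.windowBound v δ ≤ 1 := by
  have hs : 0 < N.rate 0 := lt_of_lt_of_le one_half_pos (N.half_le_rate hn (Nat.zero_le _))
  have hell : 0 < Real.log (N.rate 0)⁻¹ := Real.log_pos ((one_lt_inv₀ hs).2 (N.rate_lt_one hn 0))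
  have hTn : (0 : ℝ) < T * √n := by positivity
  rcases Nat.eq_zero_or_pos δ with rfl | hδ
  · simp [Feasible]
  obtain ⟨m, rfl⟩ : ∃ m, δ = m + 1 := ⟨δ - 1, by omega⟩
  have hlog := log_windowBound hn hv m
  have hW := windowBound_pos hn hv (m + 1)
  have hiff : ∀ β : ℝ,
      Real.log β = ∑ k ∈ Finset.Icc 1 m, Real.log (1 - N.decrease v k / N.rate 0) →
      (((m + 1 : ℕ) : ℝ) ≥ Real.log (T * √n) / Real.log (N.rate 0)⁻¹
        - Real.log β⁻¹ / Real.log (N.rate 0)⁻¹ ↔ T * √n * N.windowBound v (m + 1) ≤ 1) := by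
    intro β hβ
    rw [ge_iff_le, ← sub_div, div_le_iff₀ hell,
      ← Real.log_nonpos_iff (by positivity), Real.log_mul hTn.ne' hW.ne', hlog, Real.log_inv,
      Real.log_inv, hβ]
    constructor <;> intro h <;> linarith
  constructor
  · rintro ⟨β, _, _, h3, h4⟩
    rw [sigma2_P_zero hn hv] at h3 h4
    exact ⟨hδ, (hiff β h3).1 h4⟩
  · rintro ⟨_, h⟩
    refine ⟨Real.exp (∑ k ∈ Finset.Icc 1 m, Real.log (1 - N.decrease v k / N.rate 0)),
      Real.exp_pos _, hδ, ?_, ?_⟩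
    · rw [sigma2_P_zero hn hv, Real.log_exp, Nat.add_sub_cancel]
    · rw [sigma2_P_zero hn hv]
      exact (hiff _ (Real.log_exp _)).2 h

/-- The mixing time problem has an optimal value, which is at most the mixing time of the initial
network. -/
theorem exists_isMixingTime (hn : 2 ≤ n) (hT : 1 ≤ T) (hv : N.IsConnectivityEigenvector v) :
    ∃ δ, N.IsMixingTime v δ ∧ δ ≤ ⌈Real.log (T * √n) / Real.log (sigma2 (N.P 0))⁻¹⌉₊ := by
  have hs : 0 < N.rate 0 := lt_of_lt_of_le one_half_pos (N.half_le_rate hn (Nat.zero_le _))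
  have hell : 0 < Real.log (N.rate 0)⁻¹ := Real.log_pos ((one_lt_inv₀ hs).2 (N.rate_lt_one hn 0))
  have hTn : (1 : ℝ) < T * √n := by
    have h1 : (1 : ℝ) ≤ T := by exact_mod_cast hT
    have h2 : (1 : ℝ) < √n := by
      rw [Real.lt_sqrt zero_le_one]
      have : (2 : ℝ) ≤ n := by exact_mod_cast hn
      linarith
    nlinarith
  set q := Real.log (T * √n) / Real.log (sigma2 (N.P 0))⁻¹ with hq
  rw [sigma2_P_zero hn hv] at hq
  have hqpos : 0 < q := by
    rw [hq]
    exact div_pos (Real.log_pos hTn) hell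
  -- Ignoring all added edges only enlarges the window bound, to `σ ^ m`; `T √n > 1` makes the
  -- ceiling at least `1`.
  have hmem : ⌈q⌉₊ ∈ {d : ℕ | ∃ β : ℝ, N.Feasible v β d} := by
    refine (exists_feasible_iff hn hT hv _).2 ⟨Nat.ceil_pos.2 hqpos, ?_⟩
    have h1 : Real.log (T * √n) ≤ ⌈q⌉₊ * Real.log (N.rate 0)⁻¹ := by
      rw [← div_le_iff₀ hell, ← hq]
      exact Nat.le_ceil q
    have h2 : Real.log (T * √n * N.rate 0 ^ ⌈q⌉₊) ≤ 0 := by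
      rw [Real.log_mul (by positivity) (by positivity), Real.log_pow]
      rw [Real.log_inv] at h1
      linarith
    rw [Real.log_nonpos_iff (by positivity)] at h2
    exact (mul_le_mul_of_nonneg_left (windowBound_le_pow hn hv _) (by positivity)).trans h2
  refine ⟨sInf {d : ℕ | ∃ β : ℝ, N.Feasible v β d}, ⟨Nat.sInf_mem ⟨_, hmem⟩, fun d hd => ?_⟩, ?_⟩
  · exact Nat.sInf_le hd
  · exact Nat.sInf_le hmem

end EvolvingNetwork

/-! ### Mixing of weight products and consensus error of the dual variables. -/

section Consensus

open Matrix

variable {n T : ℕ}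

/-- The product `P (r + 1) * ⋯ * P (r + m)`. -/
def windowProd (P : ℕ → Matrix (Fin n) (Fin n) ℝ) (r : ℕ) : ℕ → Matrix (Fin n) (Fin n) ℝ
  | 0 => 1
  | m + 1 => windowProd P r m * P (r + 1 + m)

/-- The `ℓ¹` distance of a column of a matrix to the uniform distribution. -/
noncomputable def columnError (M : Matrix (Fin n) (Fin n) ℝ) (i : Fin n) : ℝ :=
  ∑ j, |M j i - 1 / (n : ℝ)|

namespace EvolvingNetwork

variable (N : EvolvingNetwork n T) {r m : ℕ}

theorem windowProd_apply_nonneg (hm : r + m ≤ T) (i j : Fin n) : 0 ≤ windowProd N.P r m i j := by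
  induction m generalizing i j with
  | zero =>
    rw [windowProd, Matrix.one_apply]
    split_ifs <;> norm_num
  | succ m ih =>
    rw [windowProd, Matrix.mul_apply]
    refine Finset.sum_nonneg fun k _ => mul_nonneg (ih (by omega) i k) ?_
    rw [P_eq_weightMatrix]
    exact weightMatrix_apply_nonneg (Nat.cast_nonneg _)
      (N.lap_apply_self_le_degMax (by omega)) k j

theorem windowProd_mulVec_one (r m : ℕ) : windowProd N.P r m *ᵥ 1 = 1 := by
  induction m with
  | zero => simp [windowProd]
  | succ m ih =>
    rw [windowProd, ← mulVec_mulVec, P_eq_weightMatrix, weightMatrix_mulVec_one, ih]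

theorem one_dotProduct_windowProd_mulVec (r m : ℕ) (w : Fin n → ℝ) :
    1 ⬝ᵥ windowProd N.P r m *ᵥ w = 1 ⬝ᵥ w := by
  induction m generalizing w with
  | zero => simp [windowProd]
  | succ m ih =>
    rw [windowProd, ← mulVec_mulVec, ih, P_eq_weightMatrix, one_dotProduct_weightMatrix_mulVec]

theorem windowProd_contraction (hn : 2 ≤ n) (hm : r + m ≤ T) {w : Fin n → ℝ} (hw : 1 ⬝ᵥ w = 0) :
    windowProd N.P r m *ᵥ w ⬝ᵥ windowProd N.P r m *ᵥ w
      ≤ (∏ k ∈ Finset.range m, N.rate (r + 1 + k)) ^ 2 * (w ⬝ᵥ w) := by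
  induction m generalizing w with
  | zero => simp [windowProd]
  | succ m ih =>
    have hs := N.half_le_rate hn (t := r + 1 + m) (by omega)
    have h1 := ih (by omega) (w := N.P (r + 1 + m) *ᵥ w)
      (by rw [P_eq_weightMatrix, one_dotProduct_weightMatrix_mulVec, hw])
    have h2 : N.P (r + 1 + m) *ᵥ w ⬝ᵥ N.P (r + 1 + m) *ᵥ w
        ≤ N.rate (r + 1 + m) ^ 2 * (w ⬝ᵥ w) :=
      weightMatrix_contraction hn (Nat.cast_nonneg _) (N.lap_apply_self_le_degMax (by omega))
        (lt_of_lt_of_le one_half_pos hs) hw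
    rw [windowProd, ← mulVec_mulVec, Finset.prod_range_succ, mul_pow, mul_assoc]
    exact h1.trans (mul_le_mul_of_nonneg_left h2 (sq_nonneg _))

theorem windowProd_mulVec_centeredSingle (r m : ℕ) (i j : Fin n) :
    (windowProd N.P r m *ᵥ centeredSingle i) j = windowProd N.P r m j i - 1 / (n : ℝ) := by
  rw [centeredSingle, mulVec_sub, mulVec_smul, windowProd_mulVec_one]
  simp

theorem columnError_windowProd_le_two (hm : r + m ≤ T) (i : Fin n) :
    columnError (windowProd N.P r m) i ≤ 2 := by
  have hn : (n : ℝ) ≠ 0 := by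
    have := i.pos
    positivity
  have hsum : ∑ j, windowProd N.P r m j i = 1 := by
    have := N.one_dotProduct_windowProd_mulVec r m (Pi.single i 1)
    simpa [dotProduct] using this
  calc columnError (windowProd N.P r m) i
      ≤ ∑ j, (windowProd N.P r m j i + 1 / (n : ℝ)) := by
        refine Finset.sum_le_sum fun j _ => ?_
        have h1 := N.windowProd_apply_nonneg hm j i
        have h2 : (0 : ℝ) ≤ 1 / n := by positivity
        rw [abs_le]
        exact ⟨by linarith, by linarith⟩
    _ = 2 := by
        rw [Finset.sum_add_distrib, hsum]
        simp [hn]; norm_num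

/-- The deviation of a column from uniform is the product applied to a centered indicator of norm at
most `1`; Cauchy–Schwarz from `ℓ²` to `ℓ¹` costs `√n`. -/
theorem columnError_windowProd_le {v : ℕ → Fin n → ℝ} (hn : 2 ≤ n)
    (hv : N.IsConnectivityEigenvector v) (hm : r + m ≤ T) (i : Fin n) :
    columnError (windowProd N.P r m) i ≤ √n * N.windowBound v m := by
  set x := windowProd N.P r m *ᵥ centeredSingle i with hx
  have herr : columnError (windowProd N.P r m) i = ∑ j, |x j| := by
    simp only [hx, windowProd_mulVec_centeredSingle, columnError]
  have hprod : (∏ k ∈ Finset.range m, N.rate (r + 1 + k)) ≤ N.windowBound v m :=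
    prod_rate_le_windowBound hn hv hm
  have hprod0 : 0 ≤ ∏ k ∈ Finset.range m, N.rate (r + 1 + k) := by
    refine Finset.prod_nonneg fun k hk => ?_
    have := Finset.mem_range.1 hk
    linarith [N.half_le_rate hn (t := r + 1 + k) (by omega)]
  have h1 : x ⬝ᵥ x ≤ N.windowBound v m ^ 2 := by
    refine (N.windowProd_contraction hn hm (one_dotProduct_centeredSingle i)).trans ?_
    rw [centeredSingle_dotProduct_self]
    refine (mul_le_of_le_one_right (sq_nonneg _) ?_).trans (pow_le_pow_left₀ hprod0 hprod 2)
    have : (0 : ℝ) ≤ 1 / n := by positivity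
    linarith
  have h2 : (∑ j, |x j|) ^ 2 ≤ n * (x ⬝ᵥ x) := by
    have h := dotProduct_sq_le (1 : Fin n → ℝ) (fun j => |x j|)
    rw [one_dotProduct_one_real] at h
    simpa [dotProduct] using h
  rw [herr]
  refine le_of_sq_le_sq ?_ (mul_nonneg (Real.sqrt_nonneg _) (windowBound_pos hn hv m).le)
  rw [mul_pow, Real.sq_sqrt (Nat.cast_nonneg _)]
  exact h2.trans (mul_le_mul_of_nonneg_left h1 (Nat.cast_nonneg _))

/-- Total consensus error over time, in terms of a feasible mixing time. -/
theorem sum_columnError_le {v : ℕ → Fin n → ℝ} (hn : 2 ≤ n) (hT : 1 ≤ T)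
    (hv : N.IsConnectivityEigenvector v) {δ t : ℕ} (hδ : T * √n * N.windowBound v δ ≤ 1)
    (ht : t ≤ T) (i : Fin n) :
    ∑ r ∈ Finset.range t, columnError (windowProd N.P r (t - 1 - r)) i ≤ 2 * δ + 1 := by
  have hT0 : (0 : ℝ) < T := by exact_mod_cast hT
  -- Short windows use the trivial bound `2`; a window of length at least `δ` has `√n W ≤ 1 / T` by
  -- feasibility and monotonicity of `W`.
  have h1 : ∀ r ∈ Finset.range t, columnError (windowProd N.P r (t - 1 - r)) i
      ≤ (if t - 1 - r < δ then (2 : ℝ) else 0) + 1 / T := by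
    intro r hr
    have hr' := Finset.mem_range.1 hr
    split_ifs with h
    · have := N.columnError_windowProd_le_two (r := r) (m := t - 1 - r) (by omega) i
      have h2 : (0 : ℝ) ≤ 1 / T := by positivity
      linarith
    · refine (N.columnError_windowProd_le (r := r) (m := t - 1 - r) hn hv (by omega) i).trans ?_
      rw [zero_add, le_div_iff₀ hT0]
      have h3 := windowBound_antitone hn hv (not_lt.1 h)
      have h4 := mul_le_mul_of_nonneg_left h3 (by positivity : (0 : ℝ) ≤ T * √n)
      linarith
  refine (Finset.sum_le_sum h1).trans ?_
  rw [Finset.sum_add_distrib,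
    Finset.sum_range_reflect (fun m => if m < δ then (2 : ℝ) else 0) t, Finset.sum_const,
    Finset.card_range, nsmul_eq_mul]
  refine add_le_add ?_ ?_
  · rw [← Finset.sum_filter, Finset.sum_const, nsmul_eq_mul, mul_comm]
    have : ((Finset.range t).filter (· < δ)).card ≤ δ := by
      calc _ ≤ (Finset.range δ).card := Finset.card_le_card fun m hm => by
            simp only [Finset.mem_filter] at hm
            exact Finset.mem_range.2 hm.2
        _ = δ := Finset.card_range δ
    gcongr
  · rw [mul_one_div, div_le_one hT0]
    exact_mod_cast ht

end EvolvingNetwork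

variable {F : Type*} [NormedAddCommGroup F] [NormedSpace ℝ F]

/-- The solution of the averaging recursion with inputs `g`. -/
theorem eq_sum_windowProd_of_recursion {P : ℕ → Matrix (Fin n) (Fin n) ℝ} {z g : ℕ → Fin n → F}
    (h0 : ∀ i, z 0 i = 0)
    (hstep : ∀ t < T, ∀ i, z (t + 1) i = (∑ j, P t j i • z t j) + g t i) {t : ℕ} (ht : t ≤ T)
    (i : Fin n) :
    z t i = ∑ r ∈ Finset.range t, ∑ j, windowProd P r (t - 1 - r) j i • g r j := by
  induction t generalizing i with
  | zero => simp [h0]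
  | succ t ih =>
    rw [hstep t (by omega), Finset.sum_range_succ]
    congr 1
    · simp_rw [ih (by omega : t ≤ T), Finset.smul_sum]
      rw [Finset.sum_comm]
      refine Finset.sum_congr rfl fun r hr => ?_
      rw [Finset.sum_comm]
      refine Finset.sum_congr rfl fun k _ => ?_
      have hr' := Finset.mem_range.1 hr
      -- The input of time `r` first enters `z (r + 1)`, so it meets `P (r + 1), …, P t` on its way
      -- to `z (t + 1)`, with `P t` as the new last factor.
      have e1 : t + 1 - 1 - r = (t - 1 - r) + 1 := by omega
      have e2 : r + 1 + (t - 1 - r) = t := by omega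
      rw [e1, windowProd, Matrix.mul_apply, e2, Finset.sum_smul]
      refine Finset.sum_congr rfl fun j _ => ?_
      rw [smul_smul, mul_comm]
    · simp [windowProd, Matrix.one_apply]

/-- The network average of the inputs. -/
noncomputable def inputAverage (g : ℕ → Fin n → F) (t : ℕ) : F := (1 / (n : ℝ)) • ∑ j, g t j

theorem norm_inputAverage_le {g : ℕ → Fin n → F} {L : ℝ} (hn : 1 ≤ n) {t : ℕ}
    (hg : ∀ i, ‖g t i‖ ≤ L) : ‖inputAverage g t‖ ≤ L := by
  have hn0 : (0 : ℝ) < n := by exact_mod_cast hn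
  rw [inputAverage, norm_smul, Real.norm_of_nonneg (by positivity), one_div_mul_eq_div,
    div_le_iff₀ hn0]
  calc ‖∑ j, g t j‖ ≤ ∑ j, ‖g t j‖ := norm_sum_le _ _
    _ ≤ ∑ _j : Fin n, L := Finset.sum_le_sum fun j _ => hg j
    _ = L * n := by simp [mul_comm]

/-- Deviation from the average in the averaging recursion. -/
theorem norm_sub_sum_inputAverage_le {P : ℕ → Matrix (Fin n) (Fin n) ℝ} {z g : ℕ → Fin n → F}
    {L : ℝ} (h0 : ∀ i, z 0 i = 0)
    (hstep : ∀ t < T, ∀ i, z (t + 1) i = (∑ j, P t j i • z t j) + g t i)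
    (hg : ∀ t ≤ T, ∀ i, ‖g t i‖ ≤ L) {t : ℕ} (ht : t ≤ T) (i : Fin n) :
    ‖z t i - ∑ r ∈ Finset.range t, inputAverage g r‖
      ≤ (∑ r ∈ Finset.range t, columnError (windowProd P r (t - 1 - r)) i) * L := by
  rw [eq_sum_windowProd_of_recursion h0 hstep ht, ← Finset.sum_sub_distrib, Finset.sum_mul]
  refine (norm_sum_le _ _).trans (Finset.sum_le_sum fun r hr => ?_)
  have hr' := Finset.mem_range.1 hr
  rw [inputAverage, Finset.smul_sum, ← Finset.sum_sub_distrib, columnError, Finset.sum_mul]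
  refine (norm_sum_le _ _).trans (Finset.sum_le_sum fun j _ => ?_)
  rw [← sub_smul, norm_smul, Real.norm_eq_abs]
  exact mul_le_mul_of_nonneg_left (hg r (by omega) j) (abs_nonneg _)

end Consensus

/-! ### Minimizers of strongly convex functions without semicontinuity. -/

section GeneralizedMinimizer

open Filter Topology

variable {E : Type*} [NormedAddCommGroup E]

/-- `y` is a limit of a minimizing sequence of `h` on `X`. For a function that is not lower
semicontinuous this takes the place of a minimizer. -/
def IsGeneralizedMin (X : Set E) (h : E → ℝ) (y : E) : Prop :=
  y ∈ X ∧ ∃ s : ℕ → E, (∀ k, s k ∈ X) ∧ Tendsto s atTop (𝓝 y) ∧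
    Tendsto (fun k => h (s k)) atTop (𝓝 (sInf (h '' X)))

theorem IsMinOn.isGeneralizedMin {X : Set E} {h : E → ℝ} {y : E} (hy : y ∈ X)
    (hmin : IsMinOn h X y) : IsGeneralizedMin X h y := by
  have : sInf (h '' X) = h y := by
    refine IsLeast.csInf_eq ⟨⟨y, hy, rfl⟩, ?_⟩
    rintro _ ⟨x, hx, rfl⟩
    exact hmin hx
  exact ⟨hy, fun _ => y, fun _ => hy, tendsto_const_nhds, by rw [this]; exact tendsto_const_nhds⟩

variable [NormedSpace ℝ E]

/-- Strong convexity at midpoints makes any minimizing sequence Cauchy: `μ / 8 ‖s j - s k‖²` is at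
most the average excess of the two values over the infimum. -/
theorem StrongConvexOn.exists_isGeneralizedMin [CompleteSpace E] {X : Set E} {h : E → ℝ} {μ : ℝ}
    (hh : StrongConvexOn X μ h) (hμ : 0 < μ) (hX : IsClosed X) (hne : X.Nonempty)
    (hbdd : BddBelow (h '' X)) : ∃ y, IsGeneralizedMin X h y := by
  set m := sInf (h '' X) with hm
  have hex : ∀ k : ℕ, ∃ x ∈ X, h x < m + 1 / ((k : ℝ) + 1) := by
    intro k
    have hlt : m < m + 1 / ((k : ℝ) + 1) := lt_add_of_pos_right _ (by positivity)
    obtain ⟨_, ⟨x, hx, rfl⟩, hxlt⟩ := exists_lt_of_csInf_lt (hne.image h) hlt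
    exact ⟨x, hx, hxlt⟩
  choose s hsX hs using hex
  have hge : ∀ x ∈ X, m ≤ h x := fun x hx => csInf_le hbdd ⟨x, hx, rfl⟩
  have hcauchy : CauchySeq s := by
    refine cauchySeq_of_le_tendsto_0 (fun N : ℕ => √(8 / μ * (1 / ((N : ℝ) + 1)))) ?_ ?_
    · intro j k N hj hk
      rw [dist_eq_norm]
      refine Real.le_sqrt_of_sq_le ?_
      have hmid := hh.2 (hsX j) (hsX k) (by norm_num : (0 : ℝ) ≤ 1 / 2)
        (by norm_num : (0 : ℝ) ≤ 1 / 2) (by norm_num)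
      have hmem := hh.1 (hsX j) (hsX k) (by norm_num : (0 : ℝ) ≤ 1 / 2)
        (by norm_num : (0 : ℝ) ≤ 1 / 2) (by norm_num)
      have h1 := hge _ hmem
      have hb : ∀ i, N ≤ i → h (s i) < m + 1 / ((N : ℝ) + 1) := fun i hi =>
        (hs i).trans_le (by gcongr)
      have hj' := hb j hj
      have hk' := hb k hk
      simp only [smul_eq_mul] at hmid
      rw [div_mul_eq_mul_div, le_div_iff₀ hμ]
      nlinarith
    · have := (tendsto_one_div_add_atTop_nhds_zero_nat (𝕜 := ℝ)).const_mul (8 / μ)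
      simpa [Function.comp_def] using (Real.continuous_sqrt.tendsto _).comp this
  obtain ⟨y, hy⟩ := cauchySeq_tendsto_of_complete hcauchy
  refine ⟨y, hX.mem_of_tendsto hy (Eventually.of_forall hsX), s, hsX, hy, ?_⟩
  refine tendsto_of_tendsto_of_tendsto_of_le_of_le tendsto_const_nhds
    (g := fun _ => m) (h := fun k : ℕ => m + 1 / ((k : ℝ) + 1)) ?_ (fun k => hge _ (hsX k))
    fun k => (hs k).le
  simpa using (tendsto_one_div_add_atTop_nhds_zero_nat (𝕜 := ℝ)).const_add m

/-- Quadratic growth of a strongly convex function around its generalized minimizer. -/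
theorem IsGeneralizedMin.growth {X : Set E} {h : E → ℝ} {μ : ℝ} {y : E}
    (hy : IsGeneralizedMin X h y) (hh : StrongConvexOn X μ h) (hbdd : BddBelow (h '' X)) {x : E}
    (hx : x ∈ X) : sInf (h '' X) + μ / 2 * ‖x - y‖ ^ 2 ≤ h x := by
  obtain ⟨-, s, hsX, hsy, hsh⟩ := hy
  set m := sInf (h '' X) with hm
  -- Compare the infimum with the value at `a x + (1 - a) s k`, let `k → ∞` and divide by `a`;
  -- afterwards `a → 0`.
  have key : ∀ a : ℝ, 0 < a → a ≤ 1 → m + (1 - a) * (μ / 2 * ‖x - y‖ ^ 2) ≤ h x := by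
    intro a ha ha1
    have h1 : ∀ k, m ≤ a * h x + (1 - a) * h (s k) - a * (1 - a) * (μ / 2 * ‖x - s k‖ ^ 2) := by
      intro k
      have hc := hh.2 hx (hsX k) ha.le (sub_nonneg.2 ha1) (by ring)
      have hmem := hh.1 hx (hsX k) ha.le (sub_nonneg.2 ha1) (by ring)
      exact (csInf_le hbdd ⟨_, hmem, rfl⟩).trans hc
    have hlim : Tendsto
        (fun k => a * h x + (1 - a) * h (s k) - a * (1 - a) * (μ / 2 * ‖x - s k‖ ^ 2)) atTop
        (𝓝 (a * h x + (1 - a) * m - a * (1 - a) * (μ / 2 * ‖x - y‖ ^ 2))) :=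
      ((hsh.const_mul (1 - a)).const_add (a * h x)).sub
        ((((tendsto_const_nhds.sub hsy).norm.pow 2).const_mul (μ / 2)).const_mul (a * (1 - a)))
    have h2 := ge_of_tendsto' hlim h1
    have h3 : a * (m + (1 - a) * (μ / 2 * ‖x - y‖ ^ 2)) ≤ a * h x := by linarith
    exact le_of_mul_le_mul_left h3 ha
  have hlim : Tendsto (fun k : ℕ => m + (1 - 1 / ((k : ℝ) + 1)) * (μ / 2 * ‖x - y‖ ^ 2)) atTop
      (𝓝 (m + (1 - 0) * (μ / 2 * ‖x - y‖ ^ 2))) :=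
    (((tendsto_one_div_add_atTop_nhds_zero_nat (𝕜 := ℝ)).const_sub 1).mul_const _).const_add m
  rw [sub_zero, one_mul] at hlim
  refine le_of_tendsto' hlim fun k => key _ (by positivity) ?_
  rw [div_le_one (by positivity)]
  linarith [(Nat.cast_nonneg k : (0 : ℝ) ≤ k)]

end GeneralizedMinimizer

/-! ### The proximal map and the regret of centralized dual averaging. -/

section DualAveraging

open Filter Topology

variable {E : Type*} [NormedAddCommGroup E] [NormedSpace ℝ E]

/-- The regularized linear objective `z(y) + ψ(y) / a`. -/
noncomputable def proxObj (ψ : E → ℝ) (a : ℝ) (z : StrongDual ℝ E) (y : E) : ℝ :=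
  z y + 1 / a * ψ y

/-- The optimal value of the regularized linear objective. -/
noncomputable def proxValue (X : Set E) (ψ : E → ℝ) (a : ℝ) (z : StrongDual ℝ E) : ℝ :=
  sInf (proxObj ψ a z '' X)

/-- A closed convex set containing the origin with a nonnegative, `1`-strongly convex function that
vanishes at the origin. -/
structure IsProxSetup (X : Set E) (ψ : E → ℝ) : Prop where
  isClosed : IsClosed X
  zero_mem : (0 : E) ∈ X
  strongConvex : StrongConvexOn X 1 ψ
  nonneg : ∀ x ∈ X, 0 ≤ ψ x
  zero : ψ 0 = 0

namespace IsProxSetup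

variable {X : Set E} {ψ : E → ℝ} (h : IsProxSetup X ψ)

include h

theorem half_norm_sq_le {x : E} (hx : x ∈ X) : ‖x‖ ^ 2 / 2 ≤ ψ x := by
  have hmin : IsMinOn ψ X 0 := fun y hy => by
    simpa [h.zero] using h.nonneg y hy
  have hbdd : BddBelow (ψ '' X) := ⟨0, by rintro _ ⟨y, hy, rfl⟩; exact h.nonneg y hy⟩
  have hinf : 0 ≤ sInf (ψ '' X) := by
    refine le_csInf ⟨_, 0, h.zero_mem, rfl⟩ ?_
    rintro _ ⟨y, hy, rfl⟩
    exact h.nonneg y hy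
  have := (hmin.isGeneralizedMin h.zero_mem).growth h.strongConvex hbdd hx
  rw [sub_zero] at this
  linarith

theorem strongConvexOn_proxObj {a : ℝ} (ha : 0 < a) (z : StrongDual ℝ E) :
    StrongConvexOn X (1 / a) (proxObj ψ a z) := by
  refine ⟨h.strongConvex.1, fun x hx y hy p q hp hq hpq => ?_⟩
  have h1 := h.strongConvex.2 hx hy hp hq hpq
  have h2 := mul_le_mul_of_nonneg_left h1 (by positivity : 0 ≤ 1 / a)
  simp only [proxObj, map_add, map_smul, smul_eq_mul] at h2 ⊢
  linarith

theorem le_proxObj {a : ℝ} (ha : 0 < a) (z : StrongDual ℝ E) {x : E} (hx : x ∈ X) :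
    -(a / 2 * ‖z‖ ^ 2) ≤ proxObj ψ a z x := by
  have h1 : -(‖z‖ * ‖x‖) ≤ z x := (abs_le.1 (z.le_opNorm x)).1
  have h2 := mul_le_mul_of_nonneg_left (h.half_norm_sq_le hx) (by positivity : 0 ≤ 1 / a)
  have h3 : 1 / a * (‖x‖ ^ 2 / 2) - ‖z‖ * ‖x‖ + a / 2 * ‖z‖ ^ 2
      = (‖x‖ - a * ‖z‖) ^ 2 / (2 * a) := by field_simp; ring
  have h4 : 0 ≤ (‖x‖ - a * ‖z‖) ^ 2 / (2 * a) := by positivity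
  rw [proxObj]
  linarith

theorem bddBelow_proxObj {a : ℝ} (ha : 0 < a) (z : StrongDual ℝ E) :
    BddBelow (proxObj ψ a z '' X) :=
  ⟨_, by rintro _ ⟨x, hx, rfl⟩; exact h.le_proxObj ha z hx⟩

theorem le_proxValue {a c : ℝ} (z : StrongDual ℝ E) (hc : ∀ x ∈ X, c ≤ proxObj ψ a z x) :
    c ≤ proxValue X ψ a z := by
  refine le_csInf ⟨_, 0, h.zero_mem, rfl⟩ ?_
  rintro _ ⟨x, hx, rfl⟩
  exact hc x hx

theorem proxValue_le {a : ℝ} (ha : 0 < a) (z : StrongDual ℝ E) {x : E} (hx : x ∈ X) :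
    proxValue X ψ a z ≤ proxObj ψ a z x :=
  csInf_le (h.bddBelow_proxObj ha z) ⟨x, hx, rfl⟩

theorem proxValue_anti {a a' : ℝ} (ha' : 0 < a') (haa' : a' ≤ a) (z : StrongDual ℝ E) :
    proxValue X ψ a z ≤ proxValue X ψ a' z := by
  refine h.le_proxValue z fun x hx => (h.proxValue_le (ha'.trans_le haa') z hx).trans ?_
  have := h.nonneg x hx
  unfold proxObj
  gcongr

theorem growth {a : ℝ} (ha : 0 < a) {z : StrongDual ℝ E} {y : E}
    (hy : IsGeneralizedMin X (proxObj ψ a z) y) {x : E} (hx : x ∈ X) :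
    proxValue X ψ a z + 1 / a / 2 * ‖x - y‖ ^ 2 ≤ proxObj ψ a z x :=
  hy.growth (h.strongConvexOn_proxObj ha z) (h.bddBelow_proxObj ha z) hx

/-- Quadratic growth around `y` pays for the linear perturbation `g (x - y)` by completing the
square. This is the one-step inequality behind the regret bound. -/
theorem proxValue_add_ge {a : ℝ} (ha : 0 < a) {z : StrongDual ℝ E} {y : E}
    (hy : IsGeneralizedMin X (proxObj ψ a z) y) (g : StrongDual ℝ E) :
    proxValue X ψ a z + g y - a / 2 * ‖g‖ ^ 2 ≤ proxValue X ψ a (z + g) := by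
  refine h.le_proxValue _ fun x hx => ?_
  have h1 := h.growth ha hy hx
  have h2 : -(‖g‖ * ‖x - y‖) ≤ g (x - y) := (abs_le.1 (g.le_opNorm _)).1
  have h3 : 1 / a / 2 * ‖x - y‖ ^ 2 - ‖g‖ * ‖x - y‖ + a / 2 * ‖g‖ ^ 2
      = (‖x - y‖ - a * ‖g‖) ^ 2 / (2 * a) := by field_simp; ring
  have h4 : 0 ≤ (‖x - y‖ - a * ‖g‖) ^ 2 / (2 * a) := by positivity
  rw [map_sub] at h2
  simp only [proxObj, add_apply] at h1 ⊢
  linarith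

/-- Growth around `y` is evaluated along a minimizing sequence for `z'`, since the value of the
objective at `y'` itself may exceed the infimum. Adding the inequality with roles exchanged gives
the Lipschitz bound. -/
theorem proxValue_add_sq_le {a : ℝ} (ha : 0 < a) {z z' : StrongDual ℝ E} {y y' : E}
    (hy : IsGeneralizedMin X (proxObj ψ a z) y) (hy' : IsGeneralizedMin X (proxObj ψ a z') y') :
    proxValue X ψ a z + 1 / a / 2 * ‖y' - y‖ ^ 2 ≤ proxValue X ψ a z' + (z - z') y' := by
  obtain ⟨-, s, hsX, hsy, hsh⟩ := hy'
  have h1 : ∀ k, proxValue X ψ a z + 1 / a / 2 * ‖s k - y‖ ^ 2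
      ≤ proxObj ψ a z' (s k) + (z - z') (s k) := by
    intro k
    have := h.growth ha hy (hsX k)
    simp only [proxObj, sub_apply] at this ⊢
    linarith
  refine le_of_tendsto_of_tendsto' (b := atTop) ?_ ?_ h1
  · exact (((hsy.sub_const y).norm.pow 2).const_mul _).const_add _
  · exact hsh.add (((z - z').continuous.tendsto y').comp hsy)

/-- The generalized proximal map is Lipschitz. -/
theorem norm_sub_le {a : ℝ} (ha : 0 < a) {z z' : StrongDual ℝ E} {y y' : E}
    (hy : IsGeneralizedMin X (proxObj ψ a z) y) (hy' : IsGeneralizedMin X (proxObj ψ a z') y') :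
    ‖y - y'‖ ≤ a * ‖z - z'‖ := by
  have h1 := h.proxValue_add_sq_le ha hy hy'
  have h2 := h.proxValue_add_sq_le ha hy' hy
  have h3 : (z - z') (y' - y) ≤ ‖z - z'‖ * ‖y - y'‖ := by
    rw [norm_sub_rev y y']
    exact (le_abs_self _).trans ((z - z').le_opNorm _)
  rw [norm_sub_rev y' y] at h1
  simp only [map_sub, sub_apply] at h1 h2 h3
  have h4 : 1 / a * ‖y - y'‖ ^ 2 ≤ ‖z - z'‖ * ‖y - y'‖ := by linarith
  rw [one_div_mul_eq_div, div_le_iff₀ ha] at h4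
  rcases (norm_nonneg (y - y')).eq_or_lt with h0 | h0
  · rw [← h0]; positivity
  · refine le_of_mul_le_mul_right ?_ h0
    linarith

theorem exists_isGeneralizedMin [CompleteSpace E] {a : ℝ} (ha : 0 < a) (z : StrongDual ℝ E) :
    ∃ y, IsGeneralizedMin X (proxObj ψ a z) y :=
  (h.strongConvexOn_proxObj ha z).exists_isGeneralizedMin (by positivity) h.isClosed
    ⟨0, h.zero_mem⟩ (h.bddBelow_proxObj ha z)

/-- The regret bound of dual averaging; the first input is not charged. -/
theorem regret_le {a : ℕ → ℝ} (ha : ∀ t, 0 < a t) (hanti : Antitone a) {L R : ℝ} (hL : 0 ≤ L)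
    (hR : 0 ≤ R) {T : ℕ} {g : ℕ → StrongDual ℝ E} (hg : ∀ t ≤ T, ‖g t‖ ≤ L) {y : ℕ → E}
    (hy : ∀ t, IsGeneralizedMin X (proxObj ψ (a t) (∑ r ∈ Finset.range (t + 1), g r)) (y t))
    {xs : E} (hxs : xs ∈ X) (hψ : ψ xs ≤ R ^ 2) :
    ∑ t ∈ Finset.range T, g (t + 1) (y t - xs)
      ≤ R ^ 2 / a T + 2 * L * R + L ^ 2 / 2 * (a 0 + ∑ t ∈ Finset.range T, a t) := by
  have hLsq : ∀ t ≤ T, ‖g t‖ ^ 2 ≤ L ^ 2 := fun t ht => by gcongr; exact hg t ht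
  -- The optimal value serves as potential: each new input adds `g (k + 1) (y k)` up to `a k L² /
  -- 2`, and shrinking the step size only raises the value because `ψ ≥ 0`. Evaluating the objective
  -- at `xs` bounds the potential from above.
  have hind : ∀ k ≤ T, ∑ t ∈ Finset.range k, g (t + 1) (y t)
      - L ^ 2 / 2 * (a 0 + ∑ t ∈ Finset.range k, a t)
      ≤ proxValue X ψ (a k) (∑ r ∈ Finset.range (k + 1), g r) := by
    intro k
    induction k with
    | zero =>
      intro _
      refine h.le_proxValue _ fun x hx => ?_
      have h1 := h.le_proxObj (ha 0) (∑ r ∈ Finset.range (0 + 1), g r) hx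
      have h2 := mul_le_mul_of_nonneg_left (hLsq 0 (Nat.zero_le _)) (ha 0).le
      simp only [zero_add, Finset.sum_range_one, Finset.sum_range_zero, add_zero] at h1 ⊢
      linarith
    | succ k ih =>
      intro hk
      have h1 := ih (by omega)
      have h2 := h.proxValue_add_ge (ha k) (hy k) (g (k + 1))
      have h3 := h.proxValue_anti (ha (k + 1)) (hanti (Nat.le_succ k))
        (∑ r ∈ Finset.range (k + 1 + 1), g r)
      have h4 := mul_le_mul_of_nonneg_left (hLsq (k + 1) hk) (ha k).le
      rw [Finset.sum_range_succ _ (k + 1)] at h3 ⊢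
      rw [Finset.sum_range_succ, Finset.sum_range_succ]
      linarith
  have h1 := (hind T le_rfl).trans (h.proxValue_le (ha T) _ hxs)
  have hnorm : ‖xs‖ ≤ 2 * R := by
    refine le_of_sq_le_sq ?_ (by positivity)
    nlinarith [h.half_norm_sq_le hxs]
  have h2 : g 0 xs ≤ 2 * L * R := by
    calc g 0 xs ≤ ‖g 0‖ * ‖xs‖ := (le_abs_self _).trans ((g 0).le_opNorm _)
      _ ≤ L * (2 * R) := mul_le_mul (hg 0 (Nat.zero_le _)) hnorm (norm_nonneg _) hL
      _ = 2 * L * R := by ring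
  have h3 : 1 / a T * ψ xs ≤ R ^ 2 / a T := by
    rw [one_div_mul_eq_div]
    exact div_le_div_of_nonneg_right hψ (ha T).le
  rw [proxObj, sum_apply, Finset.sum_range_succ'] at h1
  simp only [map_sub, Finset.sum_sub_distrib]
  linarith

end IsProxSetup

end DualAveraging

/-! ### From regret and consensus error to suboptimality. -/

section DDABound

theorem sum_Icc_one_eq_sum_range {M : Type*} [AddCommMonoid M] (F : ℕ → M) (T : ℕ) :
    ∑ t ∈ Finset.Icc 1 T, F t = ∑ t ∈ Finset.range T, F (t + 1) := by
  induction T with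
  | zero => simp
  | succ T ih => rw [Finset.sum_Icc_succ_top (by omega), ih, Finset.sum_range_succ]

variable {E : Type*} [NormedAddCommGroup E] [NormedSpace ℝ E] {n T : ℕ} {X : Set E}
  {f : Fin n → E → ℝ} {L R : ℝ} {ψ : E → ℝ}

namespace IsDistributedProblem

theorem isProxSetup (hp : IsDistributedProblem X f L ψ) : IsProxSetup X ψ :=
  ⟨hp.isClosed, hp.zero_mem, hp.ψ_strongConvex, hp.ψ_nonneg, hp.ψ_zero⟩

theorem convexOn_networkCost (hp : IsDistributedProblem X f L ψ) :
    ConvexOn ℝ X (networkCost f) := by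
  refine ⟨hp.convex, fun x hx y hy a b ha hb hab => ?_⟩
  have h : ∑ i, f i (a • x + b • y) ≤ a * ∑ i, f i x + b * ∑ i, f i y := by
    rw [Finset.mul_sum, Finset.mul_sum, ← Finset.sum_add_distrib]
    exact Finset.sum_le_sum fun i _ => (hp.f_convex i).2 hx hy ha hb hab
  have h2 := mul_le_mul_of_nonneg_left h (by positivity : (0 : ℝ) ≤ 1 / n)
  simp only [networkCost, smul_eq_mul]
  linarith

theorem networkCost_runningAverage_le (hp : IsDistributedProblem X f L ψ) (hT : 1 ≤ T)
    {x : ℕ → Fin n → E} {i : Fin n} (hx : ∀ t < T, x (t + 1) i ∈ X) :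
    networkCost f (runningAverage x T i)
      ≤ (1 / (T : ℝ)) * ∑ t ∈ Finset.range T, networkCost f (x (t + 1) i) := by
  have hT0 : (T : ℝ) ≠ 0 := by positivity
  rw [runningAverage, sum_Icc_one_eq_sum_range, Finset.smul_sum, Finset.mul_sum]
  refine hp.convexOn_networkCost.map_sum_le (fun _ _ => by positivity) ?_
    fun t ht => hx t (Finset.mem_range.1 ht)
  simp [hT0]

/-- One step of the comparison of the network cost with the averaged linearization. -/
theorem networkCost_sub_le (hp : IsDistributedProblem X f L ψ) (hn : 1 ≤ n) (hL : 0 ≤ L)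
    {x : Fin n → E} {g : Fin n → StrongDual ℝ E} {y xs : E} {D : ℝ} (hx : ∀ i, x i ∈ X)
    (hy : y ∈ X) (hg : ∀ i, ‖g i‖ ≤ L)
    (hsub : ∀ i, f i (x i) + g i (xs - x i) ≤ f i xs) (hD : ∀ i, ‖x i - y‖ ≤ D) (i : Fin n) :
    networkCost f (x i) - networkCost f xs
      ≤ ((1 / (n : ℝ)) • ∑ j, g j) (y - xs) + 3 * L * D := by
  have hn0 : (n : ℝ) ≠ 0 := by positivity
  have hD0 : 0 ≤ D := (norm_nonneg _).trans (hD i)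
  -- Three errors of size `L D`: moving `f j` from `x i` to `y`, from `y` to `x j`, and moving the
  -- linearization from `x j` to `y`.
  have hj : ∀ j, f j (x i) - f j xs ≤ g j (y - xs) + 3 * L * D := by
    intro j
    have h1 := (abs_le.1 (hp.f_lipschitz j _ (hx i) _ hy)).2
    have h2 := (abs_le.1 (hp.f_lipschitz j _ (hx j) _ hy)).1
    have h3 := mul_le_mul_of_nonneg_left (hD i) hL
    have h4 := mul_le_mul_of_nonneg_left (hD j) hL
    have h5 : g j (x j - y) ≤ L * D := by
      calc g j (x j - y) ≤ ‖g j‖ * ‖x j - y‖ := (le_abs_self _).trans ((g j).le_opNorm _)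
        _ ≤ L * D := mul_le_mul (hg j) (hD j) (norm_nonneg _) hL
    have h6 := hsub j
    simp only [map_sub] at h5 h6 ⊢
    linarith
  have hsum := mul_le_mul_of_nonneg_left (Finset.sum_le_sum fun j (_ : j ∈ Finset.univ) => hj j)
    (by positivity : (0 : ℝ) ≤ 1 / n)
  rw [Finset.sum_sub_distrib, Finset.sum_add_distrib, Finset.sum_const, Finset.card_univ,
    Fintype.card_fin, nsmul_eq_mul, mul_sub, mul_add] at hsum
  rw [smul_apply, sum_apply, smul_eq_mul]
  refine hsum.trans (le_of_eq ?_)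
  congr 1
  field_simp

end IsDistributedProblem

/-- Suboptimality of the running averages of distributed dual averaging, in terms of a bound on the
deviation of the dual variables from their network average. -/
theorem IsDDARun.networkCost_sub_le [CompleteSpace E] {P : ℕ → Matrix (Fin n) (Fin n) ℝ}
    {α : ℕ → ℝ} {x : ℕ → Fin n → E} {z g : ℕ → Fin n → StrongDual ℝ E}
    (hrun : IsDDARun P X f L ψ α T x z g) (hp : IsDistributedProblem X f L ψ) (hn : 1 ≤ n)
    (hT : 1 ≤ T) (hL : 0 ≤ L) (hR : 0 ≤ R) {xs : E} (hxs : xs ∈ X) (hψ : ψ xs ≤ R ^ 2)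
    (hα : ∀ t, 0 < α t) (hanti : Antitone α) {B : ℝ}
    (hB : ∀ t ≤ T, ∀ i, ‖z t i - ∑ r ∈ Finset.range t, inputAverage g r‖ ≤ B) (i : Fin n) :
    networkCost f (runningAverage x T i) - networkCost f xs
      ≤ (1 / (T : ℝ)) * (R ^ 2 / α T + 2 * L * R
        + L ^ 2 / 2 * (α 0 + ∑ t ∈ Finset.range T, α t)
        + 3 * L * B * ∑ t ∈ Finset.range T, α t) := by
  have hs := hp.isProxSetup
  -- The reference sequence `y` is dual averaging driven by the network averages of the agents'
  -- actual subgradients.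
  choose y hy using fun t => hs.exists_isGeneralizedMin (hα t)
    (∑ r ∈ Finset.range (t + 1), inputAverage g r)
  have hT0 : (T : ℝ) ≠ 0 := by positivity
  have hreg := hs.regret_le hα hanti hL hR
    (fun t ht => norm_inputAverage_le hn (hrun.subgradient_norm t ht)) hy hxs hψ
  have hD : ∀ t < T, ∀ j, ‖x (t + 1) j - y t‖ ≤ α t * B := by
    intro t ht j
    refine (hs.norm_sub_le (hα t)
      (IsMinOn.isGeneralizedMin (hrun.x_mem t ht j) (hrun.x_step t ht j)) (hy t)).trans ?_
    exact mul_le_mul_of_nonneg_left (hB (t + 1) ht j) (hα t).le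
  have hstep : ∀ t ∈ Finset.range T, networkCost f (x (t + 1) i) - networkCost f xs
      ≤ inputAverage g (t + 1) (y t - xs) + 3 * L * (α t * B) := by
    intro t ht
    have ht' := Finset.mem_range.1 ht
    exact hp.networkCost_sub_le hn hL (hrun.x_mem t ht') (hy t).1
      (hrun.subgradient_norm (t + 1) ht') (fun j => hrun.subgradient (t + 1) ht' j xs hxs)
      (hD t ht') i
  have hsum := Finset.sum_le_sum hstep
  rw [Finset.sum_sub_distrib, Finset.sum_add_distrib, Finset.sum_const, Finset.card_range,
    nsmul_eq_mul, ← Finset.mul_sum, ← Finset.sum_mul] at hsum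
  have hjen := hp.networkCost_runningAverage_le hT (fun t ht => hrun.x_mem t ht i)
  have hfin := mul_le_mul_of_nonneg_left
    (hsum.trans (add_le_add_left hreg _)) (by positivity : (0 : ℝ) ≤ 1 / T)
  rw [mul_sub, ← mul_assoc, one_div_mul_cancel hT0, one_mul] at hfin
  refine (sub_le_sub_right hjen _).trans (hfin.trans (le_of_eq ?_))
  ring

end DDABound

/-! ### Sums of the step sizes. -/

section StepSizes

theorem sum_range_le_three_mul_sqrt {α : ℕ → ℝ} {A : ℝ} (hA : 0 ≤ A) (h0 : α 0 = A)
    (hα : ∀ t : ℕ, 1 ≤ t → α t = A / √t) (T : ℕ) :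
    ∑ t ∈ Finset.range T, α t ≤ 3 * A * √T := by
  induction T with
  | zero => simp
  | succ T ih =>
    rw [Finset.sum_range_succ]
    rcases Nat.eq_zero_or_pos T with rfl | hT
    · simp [h0]; linarith
    rw [hα T hT]
    have hT1 : (1 : ℝ) ≤ T := by exact_mod_cast hT
    have hs : 0 < √(T : ℝ) := Real.sqrt_pos.2 (by linarith)
    have hsq : √(T : ℝ) ^ 2 = T := Real.sq_sqrt (by linarith)
    have hsq' : √((T + 1 : ℕ) : ℝ) ^ 2 = T + 1 := by
      rw [Real.sq_sqrt (by positivity)]; push_cast; rfl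
    have hs' := Real.sqrt_nonneg ((T + 1 : ℕ) : ℝ)
    -- Multiplied by `3 A` this is the induction step. The constant `3` leaves room for the extra
    -- initial term `α 0 = A`.
    have hinc : √(T : ℝ) + 1 / (3 * √(T : ℝ)) ≤ √((T + 1 : ℕ) : ℝ) := by
      refine le_of_sq_le_sq ?_ hs'
      rw [hsq', add_sq, hsq]
      have e1 : 2 * √(T : ℝ) * (1 / (3 * √(T : ℝ))) = 2 / 3 := by field_simp
      have e2 : (1 / (3 * √(T : ℝ))) ^ 2 = 1 / (9 * T) := by
        rw [div_pow, mul_pow, hsq]; norm_num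
      have e3 : 1 / (9 * (T : ℝ)) ≤ 1 / 9 := by
        apply one_div_le_one_div_of_le <;> linarith
      rw [e1, e2]
      linarith
    have h := mul_le_mul_of_nonneg_left hinc (by linarith : 0 ≤ 3 * A)
    have e : 3 * A * (1 / (3 * √(T : ℝ))) = A / √T := by field_simp
    rw [mul_add, e] at h
    linarith

theorem antitone_of_eq_div_sqrt {α : ℕ → ℝ} {A : ℝ} (hA : 0 ≤ A) (h0 : α 0 = A)
    (hα : ∀ t : ℕ, 1 ≤ t → α t = A / √t) : Antitone α := by
  refine antitone_nat_of_succ_le fun t => ?_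
  rcases Nat.eq_zero_or_pos t with rfl | ht
  · rw [hα 1 le_rfl, h0]; simp
  · rw [hα t ht, hα (t + 1) (by omega)]
    have : 0 < √(t : ℝ) := Real.sqrt_pos.2 (by exact_mod_cast ht)
    gcongr
    omega

end StepSizes

/-! ### Explicit constants and the lower bound on the mixing time. -/

section FinalBound

/-- The bound on the running averages in terms of any feasible mixing time. -/
theorem networkCost_sub_le_of_feasible {n T : ℕ} (hn : 2 ≤ n) (hT : 1 ≤ T)
    {N : EvolvingNetwork n T} {v : ℕ → Fin n → ℝ} (hv : N.IsConnectivityEigenvector v)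
    {E : Type*} [NormedAddCommGroup E] [NormedSpace ℝ E] [CompleteSpace E] {X : Set E}
    {f : Fin n → E → ℝ} {ψ : E → ℝ} {c L R q : ℝ} (hc : 0 < c) (hL : 0 < L) (hR : 0 < R)
    (hq : 0 < q) (hp : IsDistributedProblem X f L ψ) {xs : E} (hxs : xs ∈ X) (hψ : ψ xs ≤ R ^ 2)
    {α : ℕ → ℝ} (hα0 : α 0 = α 1) (hα : ∀ t : ℕ, 1 ≤ t → α t = c * (R * q / (L * √t)))
    {x : ℕ → Fin n → E} {z g : ℕ → Fin n → StrongDual ℝ E} (hrun : IsDDARun N.P X f L ψ α T x z g)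
    {δ : ℕ} (hδ1 : 1 ≤ δ) (hδ : T * √n * N.windowBound v δ ≤ 1) (i : Fin n) :
    networkCost f (runningAverage x T i) - networkCost f xs
      ≤ R * L / √T * (1 / (c * q) + 2 + 29 * c * q * δ) := by
  obtain ⟨A, hAdef⟩ : ∃ A, A = c * R * q / L := ⟨_, rfl⟩
  have hA : 0 < A := by rw [hAdef]; positivity
  have hαA : ∀ t : ℕ, 1 ≤ t → α t = A / √t := by
    intro t ht
    have : 0 < √(t : ℝ) := Real.sqrt_pos.2 (by exact_mod_cast ht)
    rw [hα t ht, hAdef]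
    field_simp
  have h0 : α 0 = A := by rw [hα0, hαA 1 le_rfl]; simp
  have hpos : ∀ t, 0 < α t := by
    intro t
    rcases Nat.eq_zero_or_pos t with rfl | ht
    · rwa [h0]
    · have : 0 < √(t : ℝ) := Real.sqrt_pos.2 (by exact_mod_cast ht)
      rw [hαA t ht]; positivity
  have hB : ∀ t ≤ T, ∀ i, ‖z t i - ∑ r ∈ Finset.range t, inputAverage g r‖ ≤ (2 * δ + 1) * L :=
    fun t ht i => (norm_sub_sum_inputAverage_le hrun.z_zero hrun.z_step hrun.subgradient_norm ht
      i).trans (mul_le_mul_of_nonneg_right (N.sum_columnError_le hn hT hv hδ ht i) hL.le)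
  have hmain := hrun.networkCost_sub_le hp (by omega) hT hL.le hR.le hxs hψ hpos
    (antitone_of_eq_div_sqrt hA.le h0 hαA) hB i
  have hS := sum_range_le_three_mul_sqrt hA.le h0 hαA T
  have hS0 : 0 ≤ ∑ t ∈ Finset.range T, α t := Finset.sum_nonneg fun t _ => (hpos t).le
  set S := ∑ t ∈ Finset.range T, α t
  have hT1 : (1 : ℝ) ≤ T := by exact_mod_cast hT
  have hs1 : 1 ≤ √(T : ℝ) := Real.one_le_sqrt.2 hT1
  have hsq : √(T : ℝ) * √T = T := Real.mul_self_sqrt (by linarith)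
  have hδ' : (1 : ℝ) ≤ δ := by exact_mod_cast hδ1
  set s := √(T : ℝ)
  have hLA : L ^ 2 * A = R * L * (c * q) := by rw [hAdef]; field_simp
  have e1 : R ^ 2 / α T = R * L * s * (1 / (c * q)) := by
    change _ = R * L * √(T : ℝ) * _
    rw [hαA T hT, hAdef]
    field_simp
  have e2 : 2 * L * R ≤ R * L * s * 2 := by
    have := mul_le_mul_of_nonneg_left hs1 (by positivity : 0 ≤ R * L)
    linarith
  have e3 : L ^ 2 / 2 * (α 0 + S) ≤ R * L * s * (2 * (c * q)) := by
    have h1 : α 0 + S ≤ 4 * A * s := by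
      rw [h0]
      have := mul_le_mul_of_nonneg_left hs1 hA.le
      linarith
    calc L ^ 2 / 2 * (α 0 + S) ≤ L ^ 2 / 2 * (4 * A * s) := by gcongr
      _ = L ^ 2 * A * (2 * s) := by ring
      _ = _ := by rw [hLA]; ring
  have e4 : 3 * L * ((2 * δ + 1) * L) * S ≤ R * L * s * (27 * (c * q) * δ) := by
    -- Since `δ ≥ 1`, `2 δ + 1 ≤ 3 δ`; the factors `3 · 3 · 3` give `27`, and the `2` of `e3` makes
    -- the total `29`.
    calc 3 * L * ((2 * δ + 1) * L) * S ≤ 3 * L * ((3 * δ) * L) * (3 * A * s) := by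
          gcongr
          linarith
      _ = L ^ 2 * A * (27 * δ * s) := by ring
      _ = _ := by rw [hLA]; ring
  have e5 : 2 * (c * q) ≤ 2 * (c * q) * δ := le_mul_of_one_le_right (by positivity) hδ'
  have e6 := mul_le_mul_of_nonneg_left e5 (by positivity : 0 ≤ R * L * s)
  have htot : R ^ 2 / α T + 2 * L * R + L ^ 2 / 2 * (α 0 + S) + 3 * L * ((2 * δ + 1) * L) * S
      ≤ R * L * s * (1 / (c * q) + 2 + 29 * c * q * δ) := by
    rw [e1]
    linarith
  have hs0 : 0 < s := by linarith
  refine (hmain.trans (mul_le_mul_of_nonneg_left htot (by positivity))).trans (le_of_eq ?_)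
  rw [← hsq]
  field_simp

/-- Every factor of the window bound is at least `1 / 2`, so a feasible `δ` must grow with `T`,
whatever the network. -/
theorem EvolvingNetwork.natCast_le_two_pow_of_feasible {n T : ℕ} (hn : 2 ≤ n)
    {N : EvolvingNetwork n T} {v : ℕ → Fin n → ℝ} (hv : N.IsConnectivityEigenvector v) {δ : ℕ}
    (hδ : T * √n * N.windowBound v δ ≤ 1) : T ≤ 2 ^ δ := by
  have hn1 : (1 : ℝ) ≤ √n := Real.one_le_sqrt.2 (by exact_mod_cast (by omega : 1 ≤ n))
  have h1 : (T : ℝ) * (1 / 2) ^ δ ≤ 1 := by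
    refine le_trans ?_ hδ
    refine mul_le_mul ?_ (half_pow_le_windowBound hn hv δ) (by positivity) (by positivity)
    exact le_mul_of_one_le_right (Nat.cast_nonneg _) hn1
  rw [one_div, inv_pow, ← div_eq_mul_inv, div_le_one (by positivity)] at h1
  exact_mod_cast h1

end FinalBound

theorem theorem2 (c : ℝ) (hc : 0 < c) :
    ∃ (C : ℝ) (T₀ : ℝ → ℕ) (K : ℝ → ℝ),
      ∀ (n T : ℕ) (_ : 2 ≤ n) (_ : 1 ≤ T) (N : EvolvingNetwork n T) (v : ℕ → Fin n → ℝ)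
        (_ : N.IsConnectivityEigenvector v)
        (E : Type*) [NormedAddCommGroup E] [NormedSpace ℝ E] [FiniteDimensional ℝ E]
        (X : Set E) (f : Fin n → E → ℝ) (ψ : E → ℝ) (L R : ℝ) (_ : 0 < L) (_ : 0 < R)
        (_ : IsDistributedProblem X f L ψ)
        (xs : E) (_ : xs ∈ X) (_ : IsMinOn (networkCost f) X xs) (_ : ψ xs ≤ R ^ 2)
        (α : ℕ → ℝ) (_ : α 0 = α 1)
        (_ : ∀ t : ℕ, 1 ≤ t → α t = c * (R * √(1 - sigma2 (N.P 0)) / (L * √t)))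
        (x : ℕ → Fin n → E) (z g : ℕ → Fin n → StrongDual ℝ E)
        (_ : IsDDARun N.P X f L ψ α T x z g),
        ∃ δ : ℕ, N.IsMixingTime v δ ∧
          1 ≤ δ ∧ δ ≤ ⌈Real.log (T * √n) / Real.log (sigma2 (N.P 0))⁻¹⌉₊ ∧
          (∀ i, networkCost f (runningAverage x T i) - networkCost f xs ≤
            K (sigma2 (N.P 0)) * (R * L * √(1 - sigma2 (N.P 0)) * δ / √T)) ∧
          (T₀ (sigma2 (N.P 0)) ≤ T →
            ∀ i, networkCost f (runningAverage x T i) - networkCost f xs ≤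
              C * (R * L * √(1 - sigma2 (N.P 0)) * δ / √T)) := by
  -- Both constants are `(1 / c + 2) M + 29 c`, with `M = 1` and `M = 1 / (1 - σ)`; the threshold
  -- makes `T ≤ 2 ^ δ` imply `δ ≥ 1 / (1 - σ)`.
  refine ⟨1 / c + 2 + 29 * c, fun s => 2 ^ ⌈1 / (1 - s)⌉₊,
    fun s => (1 / c + 2) / (1 - s) + 29 * c, ?_⟩
  intro n T hn hT N v hv E _ _ _ X f ψ L R hL hR hp xs hxs _ hψ α hα0 hα x z g hrun
  have : CompleteSpace E := FiniteDimensional.complete ℝ E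
  obtain ⟨δ, hmix, hle⟩ := EvolvingNetwork.exists_isMixingTime hn hT hv
  obtain ⟨hδ1, hδ⟩ := (EvolvingNetwork.exists_feasible_iff hn hT hv δ).1 hmix.1
  have hσ1 : sigma2 (N.P 0) < 1 := by
    rw [EvolvingNetwork.sigma2_P_zero hn hv]
    exact N.rate_lt_one hn 0
  have hσ0 : 0 ≤ sigma2 (N.P 0) := LinearMap.singularValues_nonneg _ _
  set σ := sigma2 (N.P 0)
  obtain ⟨q, hq⟩ : ∃ q, q = √(1 - σ) := ⟨_, rfl⟩
  rw [← hq] at hα ⊢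
  have hq0 : 0 < q := by rw [hq]; exact Real.sqrt_pos.2 (by linarith)
  have hqq : q * q = 1 - σ := by rw [hq]; exact Real.mul_self_sqrt (by linarith)
  have hq1 : q ≤ 1 := by rw [hq]; exact Real.sqrt_le_one.2 (by linarith)
  have hδ' : (1 : ℝ) ≤ δ := by exact_mod_cast hδ1
  have hmain := networkCost_sub_le_of_feasible hn hT hv hc hL hR hq0 hp hxs hψ hα0 hα hrun hδ1 hδ
  have hconst : 1 / (c * q) + 2 ≤ (1 / c + 2) * (1 / q) := by
    have h1 : 1 ≤ 1 / q := (one_le_div hq0).2 hq1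
    have h2 : 1 / (c * q) = 1 / c * (1 / q) := by field_simp
    rw [h2, add_mul]
    linarith
  -- The terms `1 / (c q) + 2` lack the factor `q δ` of the claimed rate; `M` measures the cost of
  -- supplying it.
  have hbound : ∀ M : ℝ, 1 / q ≤ M * (q * δ) → ∀ i,
      networkCost f (runningAverage x T i) - networkCost f xs
        ≤ ((1 / c + 2) * M + 29 * c) * (R * L * q * δ / √T) := by
    intro M hM i
    refine (hmain i).trans ?_
    have h1 := mul_le_mul_of_nonneg_left hM (by positivity : 0 ≤ 1 / c + 2)
    calc R * L / √T * (1 / (c * q) + 2 + 29 * c * q * δ)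
        ≤ R * L / √T * ((1 / c + 2) * (M * (q * δ)) + 29 * c * q * δ) := by
          refine mul_le_mul_of_nonneg_left ?_ (by positivity)
          linarith
      _ = _ := by ring
  refine ⟨δ, hmix, hδ1, hle, fun i => ?_, fun hT₀ i => ?_⟩
  · beta_reduce
    rw [div_eq_mul_one_div (1 / c + 2)]
    refine hbound _ ?_ i
    have h1 : 1 / (1 - σ) * (q * δ) = 1 / q * δ := by rw [← hqq]; field_simp
    rw [h1]
    exact le_mul_of_one_le_right (by positivity) hδ'
  · have h := hbound 1 ?_ i
    · rwa [mul_one] at h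
    have hceil : ⌈1 / (1 - σ)⌉₊ ≤ δ :=
      (Nat.pow_le_pow_iff_right one_lt_two).1
        (hT₀.trans (EvolvingNetwork.natCast_le_two_pow_of_feasible hn hv hδ))
    have h2 : 1 / (1 - σ) ≤ δ := (Nat.le_ceil _).trans (by exact_mod_cast hceil)
    rw [div_le_iff₀ (by linarith), ← hqq] at h2
    rw [one_mul, div_le_iff₀ hq0]
    linarith
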